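/- **Setting.** A *circuit DAG* over Boolean variables $x_1,\dots,x_N$ is a directed acyclic graph $G=(V,E)$ with a distinguished root, given by the lists $D_i$ of out-neighbours of its vertices $v_i$, in which no vertex has out-degree $1$; every sink is labelled with a variable, every other vertex $v_i$ with a Boolean operation $h_i$, and every edge $(v_i,v_j)$ with a bit $\sigma(i,j)$. Each vertex gets a value: a sink gets the value of its variable, and any other vertex gets $r_i=h_i\bigl(r_{j_1}^{\sigma(i,j_1)},\dots,r_{j_w}^{\sigma(i,j_w)}\bigr)$, where $D_i=(v_{j_1},\dots,v_{j_w})$, $a^1=a$ and $a^0=\neg a$. The value of $G$ is the value of its root. $G$ is an *XOR-AND DAG* if every $h_i$ is either AND (of any fan-in) or a binary XOR, and an *AND-OR-NOT DAG* if every $h_i$ is AND or OR (of any fan-in). Put $n=|V|$, $m=|E|$, let $L$ be the set of sinks, and let $\hat n=n-|L|$ be the number of vertices with at least one outgoing edge. Algorithms are quantum query algorithms: unitaries that do not depend on the input alternate with queries $|i\rangle|z\rangle|w\rangle\mapsto|i\rangle|z+y_i\rangle|w\rangle$, and a measurement in the computational basis at the end gives the output. The running time is the number of queries. The input string $y$ holds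 the circuit in the adjacency list model (the root, the out-degrees, the entries of the lists $D_i$, and the labels of vertices and edges) and the values of the variables; the alphabet is $\mathbb Z/(n+N+2)$, so that each of these items is one letter. **Theorem.** There are absolute constants $C_1,C_2$ such that for all $n,N,m$ and all $\hat n$ with $1\le\hat n\le n$ there is a quantum query algorithm that makes at most $C_1\sqrt{\hat n m}\,\log\hat n$ queries (and at most $C_1\sqrt{nm}\,\log n$ queries) and that, for every XOR-AND DAG $G$ over $N$ variables with $n$ vertices, $\hat n$ of them non-sinks, and $m$ edges, and every assignment of the variables, outputs the value of $G$ with error probability at most $C_2/\hat n$. Moreover, for every XOR-AND DAG $G$ with $k$ XOR vertices there is an AND-OR-NOT DAG $G'$ that represents the same Boolean function and has $2k$ more AND vertices than $G$, exactly $k$ OR vertices, $\hat n'\le 3\hat n$ non-sink vertices, and $m'=m+4k\le 6m$ edges. -/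

import Mathlib

open scoped Matrix

/-- The operations that can label the function-vertices of a circuit. -/
inductive Gate where
  | and
  | or
  | xor
  deriving DecidableEq

/-- The Boolean function computed by a gate on its list of arguments. -/
def Gate.eval : Gate → List Bool → Bool
  | .and, l => l.all id
  | .or, l => l.any id
  | .xor, l => l.foldr Bool.xor false

/-- A Boolean circuit with shared inputs on `n` vertices and over `N` variables: a directed acyclic
graph given by adjacency lists, whose edges lead from a gate to its arguments. The field `op` only
matters at vertices with an outgoing edge, `var` only at sinks, and `sign` only on edges. -/
structure CircuitDag (n N : ℕ) where
  /-- the list of out-neighbours of every vertex -/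
  out : Fin n → List (Fin n)
  /-- the edges form a set of pairs -/
  nodup : ∀ i, (out i).Nodup
  /-- there is no directed cycle -/
  acyclic : ∀ i, ¬ Relation.TransGen (fun a b => b ∈ out a) i i
  /-- no vertex has out-degree one -/
  degree_ne_one : ∀ i, (out i).length ≠ 1
  /-- the label of a function-vertex -/
  op : Fin n → Gate
  /-- the label of an edge; `false` means that the edge negates -/
  sign : Fin n → Fin n → Bool
  /-- the variable that labels a sink -/
  var : Fin n → Fin N
  /-- the root -/
  root : Fin n

namespace CircuitDag

variable {n N : ℕ} (G : CircuitDag n N)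

theorem wellFounded_out : WellFounded (fun j i => j ∈ G.out i) := by
  have hirr : Std.Irrefl (Relation.TransGen (fun j i => j ∈ G.out i)) :=
    ⟨fun i h => G.acyclic i (Relation.transGen_swap.mp h)⟩
  have hwf : WellFounded (Relation.TransGen (fun j i => j ∈ G.out i)) :=
    Finite.wellFounded_of_trans_of_irrefl _
  exact Subrelation.wf (fun h => Relation.TransGen.single h) hwf

/-- The value of a vertex under the assignment `x` of the variables. -/
noncomputable def value (x : Fin N → Bool) : Fin n → Bool :=
  G.wellFounded_out.fix fun i r =>
    if G.out i = [] then x (G.var i)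
    else (G.op i).eval
      ((G.out i).attach.map fun j => if G.sign i j.1 then r j.1 j.2 else !(r j.1 j.2))

theorem value_eq (x : Fin N → Bool) (i : Fin n) :
    G.value x i = if G.out i = [] then x (G.var i)
      else (G.op i).eval
        ((G.out i).map fun j => if G.sign i j then G.value x j else !(G.value x j)) := by
  unfold value
  rw [WellFounded.fix_eq]
  congr 2
  exact List.attach_map_val (l := G.out i)
    (f := fun j => if G.sign i j then G.value x j else !(G.value x j))

/-- The Boolean function represented by the circuit: the value of its root. -/
noncomputable def eval (x : Fin N → Bool) : Bool := G.value x G.root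

/-- The number of vertices with at least one outgoing edge. -/
def numNonSinks : ℕ := (Finset.univ.filter fun i => G.out i ≠ []).card

/-- The number of edges. -/
def numEdges : ℕ := ∑ i, (G.out i).length

/-- The number of function-vertices with label `g`. -/
def numGates (g : Gate) : ℕ := (Finset.univ.filter fun i => G.out i ≠ [] ∧ G.op i = g).card

/-- All function-vertices are ANDs (of any fan-in) or binary XORs. -/
def IsXorAnd : Prop :=
  ∀ i, G.out i ≠ [] → G.op i = .and ∨ (G.op i = .xor ∧ (G.out i).length = 2)

/-- All function-vertices are ANDs or ORs. -/
def IsAndOrNot : Prop :=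
  ∀ i, G.out i ≠ [] → G.op i = .and ∨ G.op i = .or

end CircuitDag

/-- The questions that can be put to the oracle. -/
inductive Query (n N : ℕ) where
  | root
  | degree (i : Fin n)
  | neighbor (i k : Fin n)
  | op (i : Fin n)
  | sign (i j : Fin n)
  | var (i : Fin n)
  | input (v : Fin N)
  deriving DecidableEq, Fintype

/-- The alphabet of the answers of the oracle; it is large enough to code every answer. -/
abbrev Answer (n N : ℕ) : Type := ZMod (n + N + 2)

/-- The input string: the circuit in the adjacency list model, together with an assignment of its
variables. Entries of an adjacency list are numbered from zero, and a position beyond the end of the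
list reads zero. -/
def CircuitDag.oracle {n N : ℕ} (G : CircuitDag n N) (x : Fin N → Bool) : Query n N → Answer n N
  | .root => ((G.root : ℕ) : Answer n N)
  | .degree i => ((G.out i).length : Answer n N)
  | .neighbor i k => (((G.out i)[(k : ℕ)]?.elim 0 fun j => (j : ℕ)) : ℕ)
  | .op i => match G.op i with
    | .and => 0
    | .or => 1
    | .xor => 2
  | .sign i j => if G.sign i j then 1 else 0
  | .var i => ((G.var i : ℕ) : Answer n N)
  | .input v => if x v then 1 else 0

/-- A quantum query algorithm with index set `I` and alphabet `A` that outputs one bit. Its state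
space has the computational basis `I × A × Work`: an index register, an answer register and
work-space. It starts in a basis state, alternates unitaries that do not depend on the input with
queries, and measures in the computational basis at the end. -/
structure QueryAlgorithm (I A : Type) [Fintype I] [DecidableEq I] [Fintype A] [DecidableEq A] where
  /-- the work-space -/
  Work : Type
  [fintypeWork : Fintype Work]
  [decidableEqWork : DecidableEq Work]
  /-- the number of queries -/
  queries : ℕ
  /-- the unitaries; only those with numbers `0, …, queries` are applied -/
  U : ℕ → Matrix.unitaryGroup (I × A × Work) ℂ
  /-- the initial basis state -/
  init : I × A × Work
  /-- the output, as a function of the outcome of the measurement -/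
  output : I × A × Work → Bool

namespace QueryAlgorithm

attribute [instance] QueryAlgorithm.fintypeWork QueryAlgorithm.decidableEqWork

variable {I A : Type} [Fintype I] [DecidableEq I] [Fintype A] [DecidableEq A] [AddCommGroup A]

/-- The query unitary `|i⟩|z⟩|w⟩ ↦ |i⟩|z + f i⟩|w⟩`, acting on vectors of amplitudes. -/
def applyQuery {W : Type} (f : I → A) (ψ : I × A × W → ℂ) : I × A × W → ℂ :=
  fun s => ψ (s.1, s.2.1 - f s.1, s.2.2)

/-- The state after `t` queries and the unitary that follows them. -/
noncomputable def state (𝒜 : QueryAlgorithm I A) (f : I → A) : ℕ → (I × A × 𝒜.Work → ℂ)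
  | 0 => (𝒜.U 0 : Matrix _ _ ℂ) *ᵥ Pi.single 𝒜.init 1
  | t + 1 => (𝒜.U (t + 1) : Matrix _ _ ℂ) *ᵥ applyQuery f (𝒜.state f t)

/-- The probability that the algorithm, run on the input `f`, outputs the bit `b`. -/
noncomputable def prob (𝒜 : QueryAlgorithm I A) (f : I → A) (b : Bool) : ℝ :=
  ∑ s, if 𝒜.output s = b then ‖𝒜.state f 𝒜.queries s‖ ^ 2 else 0

end QueryAlgorithm

set_option linter.unusedSectionVars false

/-! The heart is a general principle: a classical query algorithm that predicts the outcome of each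
of its T steps, and is wrong at most R times on an input, has a quantum counterpart that makes
O(√(RT)) queries for constant error (`GuessingMachine.exists_queryAlgorithm`).

Depth-first evaluation of the circuit is such an algorithm (`CircuitSearch.machine_spec`). A step
reads one edge with six queries and predicts that the literal on it is already known and true; this
outcome updates the state without any of the answers. A wrong prediction opens a new non-sink,
closes an AND, or uses up one of the two arguments of an XOR. So at most 1 + m + n̂ steps contain at
most 1 + 3n̂ mistakes, where n̂ counts the non-sinks. Since no out-degree is one, m ≥ 2n̂ and RT =
O(n̂m). A majority vote of about log₂ n̂ copies brings the error down to 1/n̂.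

For the principle, every input f gets a positive and a negative vector, supported on the path of f
in the decision tree and on one extra basis state w₀. Branch vectors with inner product 1 for
different branches and 0 for equal ones (`inner_posVec_negVec`) make the positive vector of f
orthogonal to the negative vector of g whenever their paths differ
(`GuessingMachine.inner_pathState`). Let N be the span of the negative vectors of the inputs with
output `false`, and let U be the reflection in the complement of N followed by the reflection that
acts at each node in the line of the positive vector of the branch taken there. Only the second
factor needs queries.

If the output is `true`, U fixes the positive vector p, so the average of the orbit of w₀ has norm
at least 1/‖p‖ (`one_le_norm_mul_norm_sum_iterate`). If it is `false`, the negative vector n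
satisfies U n = n − 2w₀, so the orbit sum telescopes and has norm at most ‖n‖
(`norm_sum_iterate_le`). A clock in uniform superposition turns the norm of the average into a
probability (`Realizes.average`). Giving predicted branches squared length O(β²) and the others
O(β⁻²), with β² = √(R/T), makes O(√(RT)) iterations enough.

For the second claim, each XOR is replaced by an OR of two ANDs. -/

/-- Amplitude vectors over a finite set of basis states. -/
abbrev Amp (W : Type) : Type := EuclideanSpace ℂ W

/-- The basis state `w`. -/
noncomputable def basisState {W : Type} (w : W) : Amp W :=
  haveI := Classical.decEq W
  EuclideanSpace.single w 1

theorem basisState_eq {W : Type} [DecidableEq W] (w : W) :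
    basisState w = EuclideanSpace.single w 1 := by
  unfold basisState
  congr!

/-! ### Unitaries that permute basis states or act blockwise -/

section BasisOperators

variable {W W' X F : Type} [Fintype W] [Fintype W'] [Fintype X] [Fintype F]

/-- The unitary that permutes the basis states. -/
noncomputable def permIso (σ : Equiv.Perm W) : Amp W ≃ₗᵢ[ℂ] Amp W :=
  LinearIsometryEquiv.piLpCongrLeft 2 ℂ ℂ σ

@[simp]
theorem permIso_apply (σ : Equiv.Perm W) (ψ : Amp W) (w : W) :
    permIso σ ψ w = ψ (σ.symm w) := by
  simp [permIso, LinearIsometryEquiv.piLpCongrLeft]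

theorem permIso_mul (σ τ : Equiv.Perm W) (ψ : Amp W) :
    permIso (σ * τ) ψ = permIso σ (permIso τ ψ) := by
  ext w; simp [Equiv.Perm.mul_def]

/-- The restriction of a vector to a fiber of the basis. -/
def fiber (e : W ≃ X × F) (ψ : Amp W) (x : X) : Amp F :=
  WithLp.toLp 2 fun k => ψ (e.symm (x, k))

@[simp]
theorem fiber_apply (e : W ≃ X × F) (ψ : Amp W) (x : X) (k : F) :
    fiber e ψ x k = ψ (e.symm (x, k)) := rfl

theorem fiber_ext (e : W ≃ X × F) {ψ φ : Amp W} (h : ∀ x, fiber e ψ x = fiber e φ x) :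
    ψ = φ := by
  ext w
  have := congrArg (fun v : Amp F => v (e w).2) (h (e w).1)
  simpa using this

theorem norm_sq_eq_sum_fiber (e : W ≃ X × F) (ψ : Amp W) :
    ‖ψ‖ ^ 2 = ∑ x, ‖fiber e ψ x‖ ^ 2 := by
  simp only [EuclideanSpace.norm_sq_eq]
  rw [← e.symm.sum_comp, Fintype.sum_prod_type]
  rfl

theorem inner_eq_sum_fiber (e : W ≃ X × F) (ψ φ : Amp W) :
    inner ℂ ψ φ = ∑ x, inner ℂ (fiber e ψ x) (fiber e φ x) := by
  simp only [PiLp.inner_apply]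
  rw [← e.symm.sum_comp, Fintype.sum_prod_type]
  rfl

/-- The unitary that acts by `L x` on the fiber over `x`. -/
noncomputable def blockOp (e : W ≃ X × F) (L : X → Amp F ≃ₗᵢ[ℂ] Amp F) : Amp W ≃ₗᵢ[ℂ] Amp W where
  toFun ψ := WithLp.toLp 2 fun w => L (e w).1 (fiber e ψ (e w).1) (e w).2
  invFun ψ := WithLp.toLp 2 fun w => (L (e w).1).symm (fiber e ψ (e w).1) (e w).2
  map_add' ψ φ := by
    ext w
    have : fiber e (ψ + φ) (e w).1 = fiber e ψ (e w).1 + fiber e φ (e w).1 := by ext; simp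
    simp [this]
  map_smul' c ψ := by
    ext w
    have : fiber e (c • ψ) (e w).1 = c • fiber e ψ (e w).1 := by ext; simp
    simp [this]
  left_inv ψ := by
    apply fiber_ext e
    intro x
    have : fiber e (WithLp.toLp 2 fun w => L (e w).1 (fiber e ψ (e w).1) (e w).2) x
        = L x (fiber e ψ x) := by ext; simp
    ext k
    simp [this]
  right_inv ψ := by
    apply fiber_ext e
    intro x
    have : fiber e (WithLp.toLp 2 fun w => (L (e w).1).symm (fiber e ψ (e w).1) (e w).2) x
        = (L x).symm (fiber e ψ x) := by ext; simp
    ext k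
    simp [this]
  norm_map' ψ := by
    have h : ∀ x, fiber e (WithLp.toLp 2 fun w => L (e w).1 (fiber e ψ (e w).1) (e w).2) x
        = L x (fiber e ψ x) := by intro x; ext; simp
    rw [← sq_eq_sq₀ (norm_nonneg _) (norm_nonneg _), norm_sq_eq_sum_fiber e,
      norm_sq_eq_sum_fiber e ψ]
    refine Finset.sum_congr rfl fun x _ => ?_
    have := h x
    simp only [LinearEquiv.coe_mk, LinearMap.coe_mk, AddHom.coe_mk]
    rw [this, LinearIsometryEquiv.norm_map]

@[simp]
theorem fiber_blockOp (e : W ≃ X × F) (L : X → Amp F ≃ₗᵢ[ℂ] Amp F) (ψ : Amp W) (x : X) :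
    fiber e (blockOp e L ψ) x = L x (fiber e ψ x) := by
  ext k
  change L (e (e.symm (x, k))).1 (fiber e ψ (e (e.symm (x, k))).1) (e (e.symm (x, k))).2 = _
  simp

/-- Every linear isometry of amplitude vectors is given by a unitary matrix. -/
theorem exists_unitary_matrix [DecidableEq W] (L : Amp W ≃ₗᵢ[ℂ] Amp W) :
    ∃ M : Matrix.unitaryGroup W ℂ, ∀ ψ : Amp W, (M : Matrix W W ℂ) *ᵥ ψ.ofLp = (L ψ).ofLp := by
  refine ⟨⟨Matrix.of fun i j => L (EuclideanSpace.single j 1) i, ?_⟩, ?_⟩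
  · rw [Matrix.mem_unitaryGroup_iff']
    ext i j
    have h := L.inner_map_map (EuclideanSpace.single i 1) (EuclideanSpace.single j (1 : ℂ))
    rw [PiLp.inner_apply] at h
    rw [Matrix.mul_apply, Matrix.one_apply]
    simp only [Matrix.star_apply, Matrix.of_apply]
    simp only [RCLike.inner_apply, EuclideanSpace.inner_single_left] at h
    simp only [RCLike.star_def]
    rw [← Finset.sum_congr rfl (fun x _ => mul_comm _ _), h]
    simp
  · intro ψ
    have hψ : ψ = ∑ j, ψ j • EuclideanSpace.single j (1 : ℂ) := by
      ext i; simp [Pi.single_apply]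
    ext i
    conv_rhs => rw [hψ]
    simp [Matrix.mulVec, dotProduct, mul_comm]

end BasisOperators

/-! ### Input-dependent unitaries and their query cost -/

section Realizes

variable {I A : Type} [Fintype I] [DecidableEq I] [Inhabited I] [Fintype A] [DecidableEq A]
  [AddCommGroup A] {W : Type} [Fintype W]

/-- The query as a permutation of the basis states. -/
def queryPerm (f : I → A) : Equiv.Perm (I × A × W) where
  toFun s := (s.1, s.2.1 + f s.1, s.2.2)
  invFun s := (s.1, s.2.1 - f s.1, s.2.2)
  left_inv s := by simp
  right_inv s := by simp

/-- The state after `t` queries and the unitary that follows them. -/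
noncomputable def evolve (f : I → A) (U : ℕ → Amp (I × A × W) ≃ₗᵢ[ℂ] Amp (I × A × W)) :
    ℕ → Amp (I × A × W) → Amp (I × A × W)
  | 0, φ => U 0 φ
  | t + 1, φ => U (t + 1) (permIso (queryPerm f) (evolve f U t φ))

/-- A state of the work-space, with both registers of the query in their initial states. -/
noncomputable def withRegisters (ψ : Amp W) : Amp (I × A × W) :=
  WithLp.toLp 2 fun s => if s.1 = default ∧ s.2.1 = 0 then ψ s.2.2 else 0

@[simp]
theorem withRegisters_apply (ψ : Amp W) (s : I × A × W) :
    withRegisters ψ s = if s.1 = default ∧ s.2.1 = 0 then ψ s.2.2 else 0 := rfl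

/-- With `q` queries, the input-dependent unitary `F` can be applied to the work-space. -/
def Realizes (q : ℕ) (F : (I → A) → Amp W ≃ₗᵢ[ℂ] Amp W) : Prop :=
  ∃ U : ℕ → Amp (I × A × W) ≃ₗᵢ[ℂ] Amp (I × A × W), ∀ f ψ,
    evolve f U q (withRegisters ψ) = withRegisters (F f ψ)

theorem evolve_congr (f : I → A) {U V : ℕ → Amp (I × A × W) ≃ₗᵢ[ℂ] Amp (I × A × W)} {t : ℕ}
    (h : ∀ s ≤ t, U s = V s) (φ : Amp (I × A × W)) : evolve f U t φ = evolve f V t φ := by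
  induction t with
  | zero => simp [evolve, h 0 le_rfl]
  | succ t ih =>
    simp only [evolve]
    rw [ih fun s hs => h s (hs.trans t.le_succ), h _ le_rfl]

/-- Parts of the work-space on which nothing happens can be added. -/
theorem Realizes.lift {q : ℕ} {F : (I → A) → Amp W ≃ₗᵢ[ℂ] Amp W} (h : Realizes q F)
    {W' X : Type} [Fintype W'] [Fintype X] (e : W' ≃ X × W) :
    Realizes q fun f => blockOp e fun _ => F f := by
  obtain ⟨U, hU⟩ := h
  let e' : I × A × W' ≃ X × (I × A × W) :=
    { toFun := fun s => ((e s.2.2).1, s.1, s.2.1, (e s.2.2).2)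
      invFun := fun s => (s.2.1, s.2.2.1, e.symm (s.1, s.2.2.2))
      left_inv := fun s => by simp
      right_inv := fun s => by simp }
  have key : ∀ f t φ x, fiber e' (evolve f (fun t => blockOp e' fun _ => U t) t φ) x
      = evolve f U t (fiber e' φ x) := by
    intro f t φ x
    induction t with
    | zero => simp [evolve]
    | succ t ih =>
      simp only [evolve, fiber_blockOp]
      rw [← ih]
      congr 1
  refine ⟨fun t => blockOp e' fun _ => U t, fun f ψ => fiber_ext e' fun x => ?_⟩
  rw [key]
  have h1 : ∀ φ : Amp W', fiber e' (withRegisters φ) x = withRegisters (fiber e φ x) := by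
    intro φ; ext s; simp [e']
  rw [h1, h1, hU, fiber_blockOp]

theorem Realizes.const (L : Amp W ≃ₗᵢ[ℂ] Amp W) :
    Realizes 0 (fun _ : I → A => L) := by
  let e : I × A × W ≃ (I × A) × W := (Equiv.prodAssoc I A W).symm
  refine ⟨fun _ => blockOp e fun _ => L, fun f ψ => fiber_ext e fun x => ?_⟩
  simp only [evolve, fiber_blockOp]
  have h1 : ∀ φ : Amp W, fiber e (withRegisters φ) x
      = (if x.1 = default ∧ x.2 = 0 then (1 : ℂ) else 0) • φ := by
    intro φ; ext s; simp only [fiber_apply, withRegisters_apply, e]; split_ifs <;> simp_all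
  rw [h1, h1, map_smul]

/-- The last unitary of the first computation and the initial one of the second merge into a single
unitary, so the query counts add exactly. -/
theorem Realizes.comp {q r : ℕ} {F G : (I → A) → Amp W ≃ₗᵢ[ℂ] Amp W}
    (hF : Realizes q F) (hG : Realizes r G) :
    Realizes (q + r) fun f => (F f).trans (G f) := by
  obtain ⟨U, hU⟩ := hF
  obtain ⟨V, hV⟩ := hG
  let T : ℕ → Amp (I × A × W) ≃ₗᵢ[ℂ] Amp (I × A × W) := fun t =>
    if t < q then U t else if t = q then (U q).trans (V 0) else V (t - q)
  have h0 : ∀ f φ, evolve f T q φ = V 0 (evolve f U q φ) := by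
    intro f φ
    rcases q with _ | q
    · simp [evolve, T]
    · simp only [evolve]
      rw [evolve_congr f (V := U) (t := q)]
      · simp [T]
      · intro s hs
        simp only [T]
        rw [if_pos (by omega)]
  have h1 : ∀ f t φ, evolve f T (q + t) φ = evolve f V t (evolve f U q φ) := by
    intro f t φ
    induction t with
    | zero => exact h0 f φ
    | succ t ih =>
      rw [← add_assoc]
      simp only [evolve]
      rw [ih]
      have : T (q + t + 1) = V (t + 1) := by
        simp only [T]
        rw [if_neg (by omega), if_neg (by omega)]
        congr 1; omega
      rw [this]
  exact ⟨T, fun f ψ => by rw [h1, hU, hV]; rfl⟩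

theorem Realizes.of_eq {q : ℕ} {F G : (I → A) → Amp W ≃ₗᵢ[ℂ] Amp W}
    (hF : Realizes q F) (h : ∀ f ψ, F f ψ = G f ψ) : Realizes q G := by
  obtain ⟨U, hU⟩ := hF
  exact ⟨U, fun f ψ => by rw [hU, h]⟩

/-- The permutation of basis states that is controlled by the answer to the query `q`. -/
def controlledPerm (q : W → I) (σ : A → Equiv.Perm W) (hq : ∀ z w, q (σ z w) = q w) (f : I → A) :
    Equiv.Perm W where
  toFun w := σ (f (q w)) w
  invFun w := (σ (f (q w))).symm w
  left_inv w := by simp [hq]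
  right_inv w := by
    have : q ((σ (f (q w))).symm w) = q w := by
      conv_rhs => rw [← (σ (f (q w))).apply_symm_apply w, hq]
    simp [this]

theorem permIso_withRegisters (Θ : Equiv.Perm (I × A × W)) (θ : Equiv.Perm W)
    (h : ∀ w, Θ (default, 0, w) = (default, 0, θ w)) (ψ : Amp W) :
    permIso Θ (withRegisters ψ) = withRegisters (permIso θ ψ) := by
  ext s
  obtain ⟨s, rfl⟩ := Θ.surjective s
  simp only [permIso_apply, Equiv.symm_apply_apply, withRegisters_apply]
  by_cases hs : s.1 = default ∧ s.2.1 = 0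
  · obtain ⟨i, z, w⟩ := s
    obtain ⟨rfl, rfl⟩ : i = default ∧ z = 0 := hs
    simp [h]
  · rw [if_neg hs, if_neg]
    intro hc
    apply hs
    obtain ⟨w, hw⟩ := θ.surjective (Θ s).2.2
    have h1 : Θ s = Θ (default, 0, w) := by
      rw [h, hw]
      exact Prod.ext hc.1 (Prod.ext hc.2 rfl)
    rw [Θ.injective h1]
    simp

/-- One query fetches the answer and one erases it: between them the answer register is negated, so
the second query resets it to zero. By `hq` both queries are the same. -/
theorem Realizes.controlled (q : W → I) (σ : A → Equiv.Perm W) (hq : ∀ z w, q (σ z w) = q w) :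
    Realizes 2 fun f => permIso (controlledPerm q σ hq f) := by
  -- The swap carries `default` to `q w`. Being an involution that depends on `w` only through `q
  -- w`, it also restores the index register at the end.
  let π : Equiv.Perm (I × A × W) :=
    { toFun := fun s => (Equiv.swap default (q s.2.2) s.1, s.2.1, s.2.2)
      invFun := fun s => (Equiv.swap default (q s.2.2) s.1, s.2.1, s.2.2)
      left_inv := fun s => by simp
      right_inv := fun s => by simp }
  let ρ : Equiv.Perm (I × A × W) :=
    { toFun := fun s => (s.1, -s.2.1, σ s.2.1 s.2.2)
      invFun := fun s => (s.1, -s.2.1, (σ (-s.2.1)).symm s.2.2)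
      left_inv := fun s => by simp
      right_inv := fun s => by simp }
  refine ⟨fun t => if t = 0 then permIso π else if t = 1 then permIso ρ else permIso π,
    fun f ψ => ?_⟩
  simp only [evolve, zero_add, one_ne_zero, if_true, if_false, OfNat.ofNat_ne_zero,
    OfNat.ofNat_ne_one, Nat.reduceAdd]
  simp only [← permIso_mul]
  apply permIso_withRegisters
  intro w
  simp [π, ρ, queryPerm, controlledPerm, hq]

end Realizes

/-! ### Independent copies and the majority vote -/

section Repetition

variable {I A : Type} [Fintype I] [DecidableEq I] [Inhabited I] [Fintype A] [DecidableEq A]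
  [AddCommGroup A] {W : Type} [Fintype W]

/-- The product of states of several copies of the work-space. -/
noncomputable def prodState {k : ℕ} (φ : Fin k → Amp W) : Amp (Fin k → W) :=
  WithLp.toLp 2 fun w => ∏ i, φ i (w i)

/-- The `i`-th copy is separated from the others. -/
def copyEquiv {k : ℕ} (W : Type) (i : Fin k) : (Fin k → W) ≃ ({j // j ≠ i} → W) × W :=
  (Equiv.funSplitAt i W).trans (Equiv.prodComm _ _)

theorem copyEquiv_symm_same {k : ℕ} (i : Fin k) (x : {j // j ≠ i} → W) (w : W) :
    (copyEquiv W i).symm (x, w) i = w := by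
  simp [copyEquiv, Equiv.funSplitAt, Equiv.piSplitAt]

theorem copyEquiv_symm_ne {k : ℕ} (i : Fin k) (x : {j // j ≠ i} → W) (w : W) (j : {j // j ≠ i}) :
    (copyEquiv W i).symm (x, w) j = x j := by
  simp [copyEquiv, Equiv.funSplitAt, Equiv.piSplitAt, j.2]

/-- In a product state the other copies enter only as a scalar, so by linearity a unitary on one
copy acts as if that copy were alone. -/
theorem fiber_prodState {k : ℕ} (φ : Fin k → Amp W) (i : Fin k) (x : {j // j ≠ i} → W) :
    fiber (copyEquiv W i) (prodState φ) x = (∏ j : {j // j ≠ i}, φ j (x j)) • φ i := by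
  ext w
  simp only [fiber_apply, prodState, PiLp.smul_apply, smul_eq_mul]
  rw [Fintype.prod_eq_mul_prod_subtype_ne _ i, copyEquiv_symm_same, mul_comm]
  congr 1
  exact Finset.prod_congr rfl fun j _ => by rw [copyEquiv_symm_ne]

theorem blockOp_prodState {k : ℕ} (φ : Fin k → Amp W) (i : Fin k) (L : Amp W ≃ₗᵢ[ℂ] Amp W) :
    blockOp (copyEquiv W i) (fun _ => L) (prodState φ)
      = prodState (Function.update φ i (L (φ i))) := by
  refine fiber_ext (copyEquiv W i) fun x => ?_
  rw [fiber_blockOp, fiber_prodState, fiber_prodState, map_smul, Function.update_self]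
  congr 1
  exact Finset.prod_congr rfl fun j _ => by rw [Function.update_of_ne j.2]

/-- The first `s` of `k` copies can be run one after the other. -/
theorem Realizes.copies {q : ℕ} {F : (I → A) → Amp W ≃ₗᵢ[ℂ] Amp W} (h : Realizes q F)
    (δ : Amp W) {k : ℕ} (s : ℕ) (hs : s ≤ k) :
    ∃ G : (I → A) → Amp (Fin k → W) ≃ₗᵢ[ℂ] Amp (Fin k → W), Realizes (q * s) G ∧
      ∀ f, G f (prodState fun _ => δ) = prodState fun i => if i.val < s then F f δ else δ := by
  induction s with
  | zero => exact ⟨_, Realizes.const (LinearIsometryEquiv.refl ℂ _), fun f => by simp⟩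
  | succ s ih =>
    obtain ⟨G, hG, hG'⟩ := ih (Nat.le_of_succ_le hs)
    refine ⟨_, hG.comp (h.lift (copyEquiv W ⟨s, hs⟩)), fun f => ?_⟩
    rw [LinearIsometryEquiv.trans_apply, hG', blockOp_prodState]
    congr 1
    funext i
    rcases eq_or_ne i ⟨s, hs⟩ with rfl | hi
    · simp
    · rw [Function.update_of_ne hi]
      have : i.val ≠ s := fun hc => hi (Fin.ext hc)
      have : i.val < s + 1 ↔ i.val < s := by omega
      simp [this]

/-- What can be realized on the work-space can be turned into an algorithm. -/
theorem Realizes.exists_algorithm {q : ℕ} {F : (I → A) → Amp W ≃ₗᵢ[ℂ] Amp W}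
    (h : Realizes q F) (w₀ : W) (out : W → Bool) :
    ∃ 𝒜 : QueryAlgorithm I A, 𝒜.queries = q ∧ ∀ f b,
      𝒜.prob f b = ∑ w, if out w = b then ‖F f (basisState w₀) w‖ ^ 2 else 0 := by
  classical
  obtain ⟨U, hU⟩ := h
  choose M hM using fun t => exists_unitary_matrix (U t)
  let 𝒜 : QueryAlgorithm I A :=
    { Work := W, queries := q, U := M, init := (default, 0, w₀), output := fun s => out s.2.2 }
  have hstate : ∀ f t, 𝒜.state f t
      = (evolve f U t (withRegisters (basisState w₀))).ofLp := by
    intro f t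
    induction t with
    | zero =>
      rw [QueryAlgorithm.state, evolve, ← hM]
      congr 1
      funext s
      obtain ⟨i, z, w⟩ := s
      by_cases h1 : i = default <;> by_cases h2 : z = 0 <;> by_cases h3 : w = w₀ <;>
        simp [𝒜, basisState_eq, h1, h2, h3]
    | succ t ih =>
      rw [QueryAlgorithm.state, evolve, ← hM, ih]
      congr 1
  refine ⟨𝒜, rfl, fun f b => ?_⟩
  have hfin : 𝒜.state f 𝒜.queries = (withRegisters (F f (basisState w₀))).ofLp := by
    rw [hstate, ← hU]
  unfold QueryAlgorithm.prob
  rw [hfin]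
  simp only [𝒜]
  rw [Fintype.sum_prod_type, Finset.sum_eq_single default, Fintype.sum_prod_type,
    Finset.sum_eq_single 0]
  · simp
  · intro z _ hz; simp [hz]
  · simp
  · intro i _ hi; simp [hi]
  · simp

/-- The majority vote of `k` bits. -/
def majority {k : ℕ} (c : Fin k → Bool) : Bool :=
  decide (k ≤ 2 * (Finset.univ.filter fun i => c i = true).card)

/-- Ties go to `true`; the weak inequality is the form that holds for both bits. -/
theorem card_le_of_majority_eq {k : ℕ} {c : Fin k → Bool} {b : Bool} (h : majority c = b) :
    k ≤ 2 * (Finset.univ.filter fun i => c i = b).card := by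
  cases b
  · have h1 : ¬ k ≤ 2 * (Finset.univ.filter fun i => c i = true).card := by
      simpa [majority] using h
    have h2 := Finset.card_filter_add_card_filter_not (s := (Finset.univ : Finset (Fin k)))
      (fun i => c i = true)
    simp only [Bool.not_eq_true, Finset.card_univ, Fintype.card_fin] at h2
    omega
  · simpa [majority] using h

/-- The weights of a Chernoff bound: the winning bit has at least half of the votes, so its factors
4 compensate the factors 1/4. The product dominates the indicator of the vote and factors over the
copies. -/
theorem one_le_prod_of_majority_eq {k : ℕ} {c : Fin k → Bool} {b : Bool} (h : majority c = b) :
    (1 : ℝ) ≤ ∏ i, if c i = b then 4 else 1 / 4 := by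
  have hk := card_le_of_majority_eq h
  set a := (Finset.univ.filter fun i => c i = b).card with ha
  have h2 := Finset.card_filter_add_card_filter_not (s := (Finset.univ : Finset (Fin k)))
    (fun i => c i = b)
  rw [← ha, Finset.card_univ, Fintype.card_fin] at h2
  rw [Finset.prod_ite, Finset.prod_const, Finset.prod_const, ← ha]
  obtain ⟨d, hd⟩ : ∃ d, a = (Finset.univ.filter fun i => ¬ c i = b).card + d :=
    ⟨a - (Finset.univ.filter fun i => ¬ c i = b).card, by omega⟩
  rw [hd, pow_add]
  have : (4 : ℝ) ^ (Finset.univ.filter fun i => ¬ c i = b).card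
      * (1 / 4) ^ (Finset.univ.filter fun i => ¬ c i = b).card = 1 := by
    rw [← mul_pow]; norm_num
  have h4 : (1 : ℝ) ≤ 4 ^ d := one_le_pow₀ (by norm_num)
  nlinarith

/-- The error probability of the majority vote decays exponentially with the number of copies. -/
theorem Realizes.exists_majority_algorithm {q : ℕ}
    {F : (I → A) → Amp W ≃ₗᵢ[ℂ] Amp W} (h : Realizes q F) (w₀ : W) (out : W → Bool) (k : ℕ) :
    ∃ 𝒜 : QueryAlgorithm I A, 𝒜.queries = q * k ∧ ∀ f b,
      (∑ w, if out w = b then ‖F f (basisState w₀) w‖ ^ 2 else 0) ≤ 1 / 16 →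
      𝒜.prob f b ≤ (1 / 2) ^ k := by
  classical
  obtain ⟨G, hG, hG'⟩ := h.copies (basisState w₀) (k := k) k le_rfl
  obtain ⟨𝒜, hq, h𝒜⟩ := hG.exists_algorithm (fun _ => w₀) (fun w => majority fun i => out (w i))
  refine ⟨𝒜, hq, fun f b hb => ?_⟩
  have hinit : basisState (fun _ : Fin k => w₀)
      = prodState fun _ => basisState w₀ := by
    ext w
    simp only [prodState, basisState_eq, PiLp.single_apply]
    rw [Finset.prod_ite_zero]
    simp [funext_iff]
  rw [h𝒜, hinit, hG']
  set φ := F f (basisState w₀)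
  have hφ : ∑ w, ‖φ w‖ ^ 2 = 1 := by
    rw [← EuclideanSpace.norm_sq_eq, LinearIsometryEquiv.norm_map, basisState_eq]; simp
  calc _ ≤ ∑ w : Fin k → W, ∏ i, (if out (w i) = b then 4 else 1 / 4) * ‖φ (w i)‖ ^ 2 := by
        refine Finset.sum_le_sum fun w _ => ?_
        have hnn : 0 ≤ ∏ i, ‖φ (w i)‖ ^ 2 := Finset.prod_nonneg fun i _ => by positivity
        rw [Finset.prod_mul_distrib]
        split_ifs with hw
        · have h1 := one_le_prod_of_majority_eq hw
          have h2 : ‖prodState (fun i : Fin k => if i.val < k then φ else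
              basisState w₀) w‖ ^ 2 = ∏ i, ‖φ (w i)‖ ^ 2 := by
            simp [prodState, norm_prod, Finset.prod_pow]
          rw [h2]
          nlinarith
        · apply mul_nonneg _ hnn
          exact Finset.prod_nonneg fun i _ => by split_ifs <;> norm_num
    _ = (∑ w, (if out w = b then 4 else 1 / 4) * ‖φ w‖ ^ 2) ^ k := by
        rw [← Fin.prod_const, Finset.prod_univ_sum, Fintype.piFinset_univ]
    _ ≤ (1 / 2) ^ k := by
        apply pow_le_pow_left₀
        · exact Finset.sum_nonneg fun w _ => by split_ifs <;> positivity
        -- Each copy contributes at most `4 · 1/16 + 1/4 · 1 ≤ 1/2`.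
        · have : ∀ w, (if out w = b then (4 : ℝ) else 1 / 4) * ‖φ w‖ ^ 2
              ≤ 4 * (if out w = b then ‖φ w‖ ^ 2 else 0) + 1 / 4 * ‖φ w‖ ^ 2 := by
            intro w
            have := sq_nonneg ‖φ w‖
            split_ifs <;> nlinarith
          refine (Finset.sum_le_sum fun w _ => this w).trans ?_
          rw [Finset.sum_add_distrib, ← Finset.mul_sum, ← Finset.mul_sum, hφ]
          linarith

end Repetition

/-! ### Averages of orbits of a unitary -/

section PhaseDetection

/-- A unitary that prepares the uniform superposition and can be used to detect it. -/
theorem exists_uniform_iso (M : ℕ) : ∃ D : Amp (Fin (M + 1)) ≃ₗᵢ[ℂ] Amp (Fin (M + 1)),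
    (∀ c, D (EuclideanSpace.single 0 1) c = ((1 / Real.sqrt (M + 1) : ℝ) : ℂ)) ∧
    ∀ χ, D χ 0 = ((1 / Real.sqrt (M + 1) : ℝ) : ℂ) * ∑ c, χ c := by
  set r : ℝ := 1 / Real.sqrt (M + 1) with hr
  have hM : (0 : ℝ) < M + 1 := by positivity
  have hr0 : 0 < r := by positivity
  have hr2 : r ^ 2 * (M + 1) = 1 := by
    rw [hr, div_pow, Real.sq_sqrt hM.le]; field_simp
  let e : Amp (Fin (M + 1)) := EuclideanSpace.single 0 1
  let u : Amp (Fin (M + 1)) := WithLp.toLp 2 fun _ => (r : ℂ)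
  have he : ‖e‖ = 1 := by simp [e]
  have hu : ‖u‖ ^ 2 = 1 := by
    rw [EuclideanSpace.norm_sq_eq]
    simp only [u, Finset.sum_const, Finset.card_univ, Fintype.card_fin, nsmul_eq_mul,
      Complex.norm_real, Real.norm_eq_abs, sq_abs]
    push_cast
    linarith
  have heu : inner ℂ e u = (r : ℂ) := by
    simp [e, u, EuclideanSpace.inner_single_left]
  have hue : inner ℂ u e = (r : ℂ) := by
    rw [← inner_conj_symm, heu, Complex.conj_ofReal]
  have hee : inner ℂ e e = (1 : ℂ) := by
    rw [inner_self_eq_norm_sq_to_K, he]; simp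
  have huu : inner ℂ u u = (1 : ℂ) := by
    rw [inner_self_eq_norm_sq_to_K, ← RCLike.ofReal_pow, hu]; simp
  have hse : inner ℂ (e + u) e = (1 + r : ℂ) := by
    rw [inner_add_left, hee, hue]
  have hss : ((‖e + u‖ : ℂ)) ^ 2 = (2 * (1 + r) : ℂ) := by
    have := inner_self_eq_norm_sq_to_K (𝕜 := ℂ) (e + u)
    rw [inner_add_left, inner_add_right, inner_add_right, hee, hue, heu, huu] at this
    refine Eq.trans this.symm ?_
    ring
  -- Two unit vectors with real inner product are exchanged by the reflection in the line of their
  -- sum. So `D` is its own inverse and serves for preparation as well as for detection.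
  let D := (ℂ ∙ (e + u)).reflection
  have hD : D e = u := by
    have h1 : (1 + r : ℂ) ≠ 0 := by
      have : (1 + r : ℝ) ≠ 0 := by positivity
      exact_mod_cast this
    change (ℂ ∙ (e + u)).reflection e = u
    rw [Submodule.reflection_singleton_apply, hse]
    simp only [Complex.coe_algebraMap]
    rw [hss, ← Nat.cast_smul_eq_nsmul ℂ 2, smul_smul]
    have : ((2 : ℕ) : ℂ) * ((1 + r) / (2 * (1 + r))) = 1 := by
      push_cast; field_simp
    rw [this, one_smul]; abel
  refine ⟨D, fun c => ?_, fun χ => ?_⟩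
  · change D e c = _
    rw [hD]
  · have h1 : D χ 0 = inner ℂ e (D χ) := by simp [e, EuclideanSpace.inner_single_left]
    have h2 : inner ℂ e (D χ) = inner ℂ (D e) (D (D χ)) := (D.inner_map_map _ _).symm
    have h3 : D (D χ) = χ := Submodule.reflection_reflection _ _
    rw [h1, h2, h3, hD, PiLp.inner_apply]
    simp [u, ← Finset.mul_sum, mul_comm]

variable {E : Type} [NormedAddCommGroup E] [InnerProductSpace ℂ E]

theorem inner_iterate_of_fixed {U : E ≃ₗᵢ[ℂ] E} {p : E} (hp : U p = p) (v : E) (t : ℕ) :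
    inner ℂ p (U^[t] v) = inner ℂ p v := by
  induction t with
  | zero => rfl
  | succ t ih =>
    rw [Function.iterate_succ_apply', ← ih]
    conv_lhs => rw [← hp]
    exact U.inner_map_map _ _

/-- A fixed vector that overlaps with `v` bounds the average of the orbit of `v` from below. -/
theorem one_le_norm_mul_norm_sum_iterate {U : E ≃ₗᵢ[ℂ] E} {p v : E} (hp : U p = p)
    (hpv : inner ℂ p v = (1 : ℂ)) (M : ℕ) :
    (M : ℝ) ≤ ‖p‖ * ‖∑ t ∈ Finset.range M, U^[t] v‖ := by
  have h : inner ℂ p (∑ t ∈ Finset.range M, U^[t] v) = (M : ℂ) := by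
    rw [inner_sum, Finset.sum_congr rfl fun t _ => inner_iterate_of_fixed hp v t]
    simp [hpv]
  have h2 := norm_inner_le_norm (𝕜 := ℂ) p (∑ t ∈ Finset.range M, U^[t] v)
  rw [h] at h2
  simpa using h2

/-- Since `2v = n − U n`, the orbit sum telescopes. -/
theorem two_smul_sum_iterate {U : E ≃ₗᵢ[ℂ] E} {n v : E} (hn : U n = n - (2 : ℂ) • v) (M : ℕ) :
    (2 : ℂ) • ∑ t ∈ Finset.range M, U^[t] v = n - U^[M] n := by
  induction M with
  | zero => simp
  | succ M ih =>
    rw [Finset.sum_range_succ, smul_add, ih, Function.iterate_succ_apply, hn]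
    have h : ∀ (t : ℕ) (x y : E), U^[t] (x - (2 : ℂ) • y) = U^[t] x - (2 : ℂ) • U^[t] y := by
      intro t
      induction t with
      | zero => intro x y; rfl
      | succ t ih =>
        intro x y
        simp only [Function.iterate_succ_apply, map_sub, map_smul, ih]
    rw [h]; abel

/-- If `v` is a small coboundary, the average of its orbit is small. -/
theorem norm_sum_iterate_le {U : E ≃ₗᵢ[ℂ] E} {n v : E} (hn : U n = n - (2 : ℂ) • v) (M : ℕ) :
    ‖∑ t ∈ Finset.range M, U^[t] v‖ ≤ ‖n‖ := by
  have h1 := congrArg norm (two_smul_sum_iterate hn M)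
  rw [norm_smul] at h1
  have h2 : ‖U^[M] n‖ = ‖n‖ := by
    clear h1
    induction M with
    | zero => rfl
    | succ M ih => rw [Function.iterate_succ_apply', U.norm_map, ih]
  have h3 := norm_sub_le n (U^[M] n)
  have h4 : ‖(2 : ℂ)‖ = 2 := by simp
  rw [h4] at h1
  linarith

end PhaseDetection

/-! ### Powers of a unitary controlled by a clock -/

section Clock

variable {I A : Type} [Fintype I] [DecidableEq I] [Inhabited I] [Fintype A] [DecidableEq A]
  [AddCommGroup A] {C S Y K : Type} [Fintype C] [Fintype S] [Fintype Y] [Fintype K]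
  [DecidableEq S]

/-- The family `Ψ` of states of the main register, indexed by the clock, when the auxiliary
register holds a function `a` of the address `y`. -/
noncomputable def slotState (a : Y → S) (Ψ : C → Amp (Y × K)) : Amp (C × S × Y × K) :=
  WithLp.toLp 2 fun w => if w.2.1 = a w.2.2.1 then Ψ w.1 w.2.2 else 0

/-- `V` is prescribed only where the slot holds `a₀`. Injectivity does the rest: no basis state with
other slot content can land on the graph of `a`. -/
theorem permIso_slotState {a₀ : S} {a : Y → S} {V : Equiv.Perm (C × S × Y × K)}
    (hV : ∀ c y k, V (c, a₀, y, k) = (c, a y, y, k)) (Ψ : C → Amp (Y × K)) :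
    permIso V (slotState (fun _ => a₀) Ψ) = slotState a Ψ := by
  ext w
  obtain ⟨w, rfl⟩ := V.surjective w
  rw [permIso_apply, Equiv.symm_apply_apply]
  by_cases hw : w.2.1 = a₀
  · obtain ⟨c, s, y, k⟩ := w
    obtain rfl : s = a₀ := hw
    simp [slotState, hV]
  · have : (V w).2.1 ≠ a (V w).2.2.1 := by
      intro hc
      have h1 : V w = V ((V w).1, a₀, (V w).2.2.1, (V w).2.2.2) := by
        rw [hV, ← hc]
      apply hw
      rw [V.injective h1]
    simp [slotState, hw, this]

theorem permIso_inv_slotState {a₀ : S} {a : Y → S} {V : Equiv.Perm (C × S × Y × K)}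
    (hV : ∀ c y k, V (c, a₀, y, k) = (c, a y, y, k)) (Ψ : C → Amp (Y × K)) :
    permIso V⁻¹ (slotState a Ψ) = slotState (fun _ => a₀) Ψ := by
  rw [← permIso_slotState hV, ← permIso_mul, inv_mul_cancel]
  ext w
  rw [permIso_apply]
  rfl

/-- Unitaries on a small register that depend on an address and on data computed from the address
and the input. -/
theorem Realizes.blockOp_of_compute {q : ℕ} {a₀ : S} {a : (I → A) → Y → S}
    {V : (I → A) → Equiv.Perm (C × S × Y × K)}
    (hV : ∀ f c y k, V f (c, a₀, y, k) = (c, a f y, y, k))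
    (h : Realizes q fun f => permIso (V f)) (h' : Realizes q fun f => permIso (V f)⁻¹)
    (L : C → S → Y → Amp K ≃ₗᵢ[ℂ] Amp K) :
    ∃ G : (I → A) → Amp (C × S × Y × K) ≃ₗᵢ[ℂ] Amp (C × S × Y × K), Realizes (q + q) G ∧
      ∀ f Ψ, G f (slotState (fun _ => a₀) Ψ) = slotState (fun _ => a₀) fun c =>
        blockOp (Equiv.refl (Y × K)) (fun y => L c (a f y) y) (Ψ c) := by
  let e : C × S × Y × K ≃ (C × S × Y) × K :=
    { toFun := fun w => ((w.1, w.2.1, w.2.2.1), w.2.2.2)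
      invFun := fun w => (w.1.1, w.1.2.1, w.1.2.2, w.2)
      left_inv := fun w => rfl
      right_inv := fun w => rfl }
  refine ⟨_, (h.comp (Realizes.const (blockOp e fun x => L x.1 x.2.1 x.2.2))).comp h',
    fun f Ψ => ?_⟩
  simp only [LinearIsometryEquiv.trans_apply]
  rw [permIso_slotState (hV f), ← permIso_inv_slotState (hV f)]
  congr 1
  refine fiber_ext e fun x => ?_
  rw [fiber_blockOp]
  obtain ⟨c, s, y⟩ := x
  have h1 : ∀ Φ : C → Amp (Y × K), fiber e (slotState (a f) Φ) (c, s, y)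
      = (if s = a f y then (1 : ℂ) else 0) • fiber (Equiv.refl (Y × K)) (Φ c) y := by
    intro Φ
    ext k
    by_cases hs : s = a f y <;> simp [e, slotState, hs]
  rw [h1, h1, map_smul, fiber_blockOp]
  by_cases hs : s = a f y
  · rw [hs]
  · simp [hs]

/-- The powers of a product of two unitaries, one of them fixed and the other one as in
`Realizes.blockOp_of_compute`, can be averaged. -/
theorem Realizes.average {M q : ℕ} {a₀ : S} {a : (I → A) → Y → S}
    {V : (I → A) → Equiv.Perm (Fin (M + 1) × S × Y × K)}
    (hV : ∀ f c y k, V f (c, a₀, y, k) = (c, a f y, y, k))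
    (h : Realizes q fun f => permIso (V f)) (h' : Realizes q fun f => permIso (V f)⁻¹)
    (L : S → Y → Amp K ≃ₗᵢ[ℂ] Amp K) (R : Amp (Y × K) ≃ₗᵢ[ℂ] Amp (Y × K)) (v : Y × K) :
    ∃ G : (I → A) → Amp (Fin (M + 1) × S × Y × K) ≃ₗᵢ[ℂ] Amp (Fin (M + 1) × S × Y × K),
      Realizes ((q + q) * M) G ∧
      ∀ f, ∑ w, (if w.1 = 0 then ‖G f (basisState (0, a₀, v)) w‖ ^ 2 else 0)
        = (‖∑ t ∈ Finset.range (M + 1),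
            (R.trans (blockOp (Equiv.refl (Y × K)) fun y => L (a f y) y))^[t]
              (basisState v)‖ / (M + 1)) ^ 2 := by
  classical
  obtain ⟨D, hD, hD'⟩ := exists_uniform_iso M
  set r : ℝ := 1 / Real.sqrt (M + 1) with hr
  have hr2 : r * r = 1 / (M + 1) := by
    have hM : (0 : ℝ) < M + 1 := by positivity
    rw [hr, div_mul_div_comm, Real.mul_self_sqrt hM.le, one_mul]
  set U : (I → A) → Amp (Y × K) ≃ₗᵢ[ℂ] Amp (Y × K) := fun f =>
    R.trans (blockOp (Equiv.refl (Y × K)) fun y => L (a f y) y)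
  let e : Fin (M + 1) × S × Y × K ≃ (Fin (M + 1) × S) × (Y × K) :=
    (Equiv.prodAssoc _ _ _).symm
  let e' : Fin (M + 1) × S × Y × K ≃ (S × Y × K) × Fin (M + 1) := Equiv.prodComm _ _
  set v₁ : Amp (Y × K) := basisState v
  have step : ∀ s : ℕ, s ≤ M → ∃ G : (I → A) → Amp (Fin (M + 1) × S × Y × K) ≃ₗᵢ[ℂ]
      Amp (Fin (M + 1) × S × Y × K), Realizes ((q + q) * s) G ∧
      ∀ f, G f (basisState (0, a₀, v))
        = slotState (fun _ => a₀) fun c : Fin (M + 1) => (r : ℂ) • (U f)^[min s c] v₁ := by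
    intro s hs
    induction s with
    | zero =>
      refine ⟨_, Realizes.const (blockOp e' fun _ => D), fun f => fiber_ext e' fun x => ?_⟩
      have h0 : fiber e' (basisState ((0 : Fin (M + 1)), a₀, v)) x
          = (if x = (a₀, v) then (1 : ℂ) else 0) • EuclideanSpace.single 0 1 := by
        ext c
        by_cases hx : x = (a₀, v) <;> by_cases hc : c = 0 <;> simp [e', basisState_eq, hx, hc]
      rw [fiber_blockOp, h0, map_smul]
      ext c
      obtain ⟨s, y⟩ := x
      by_cases hx : s = a₀ <;> by_cases hy : y = v <;>
        simp [e', slotState, hx, hy, hD, v₁, basisState_eq]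
    | succ s ih =>
      obtain ⟨G, hG, hG'⟩ := ih (Nat.le_of_succ_le hs)
      -- Round `s` acts only on clock values above `s`, so the value `c` has accumulated the power
      -- `min s c` before it and ends with the power `c`.
      obtain ⟨G₂, hG₂, hG₂'⟩ := Realizes.blockOp_of_compute hV h h' fun c a y =>
        if s < c.val then L a y else LinearIsometryEquiv.refl ℂ _
      let G₁ : Amp (Fin (M + 1) × S × Y × K) ≃ₗᵢ[ℂ] Amp (Fin (M + 1) × S × Y × K) :=
        blockOp e fun x => if s < x.1.val then R else LinearIsometryEquiv.refl ℂ _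
      have hG₁ : ∀ Ψ : Fin (M + 1) → Amp (Y × K), G₁ (slotState (fun _ => a₀) Ψ)
          = slotState (fun _ => a₀) fun c => if s < c.val then R (Ψ c) else Ψ c := by
        intro Ψ
        refine fiber_ext e fun x => ?_
        have h1 : ∀ Φ : Fin (M + 1) → Amp (Y × K), fiber e (slotState (fun _ => a₀) Φ) x
            = (if x.2 = a₀ then (1 : ℂ) else 0) • Φ x.1 := by
          intro Φ
          ext k
          by_cases hx : x.2 = a₀ <;> simp [e, slotState, hx]
        simp only [G₁]
        rw [fiber_blockOp, h1, h1, map_smul]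
        split_ifs <;> rfl
      refine ⟨_, ((hG.comp (Realizes.const G₁)).comp hG₂).of_eq (fun f ψ => rfl), fun f => ?_⟩
      simp only [LinearIsometryEquiv.trans_apply]
      rw [hG', hG₁, hG₂']
      congr 1
      funext c
      by_cases hc : s < c.val
      · rw [if_pos hc, min_eq_left hc.le, min_eq_left (Nat.succ_le_of_lt hc),
          Function.iterate_succ_apply']
        simp only [if_pos hc, map_smul]
        rfl
      · rw [if_neg hc, min_eq_right (by omega), min_eq_right (by omega)]
        refine fiber_ext (Equiv.refl (Y × K)) fun y => ?_
        rw [fiber_blockOp, if_neg hc]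
        rfl
  obtain ⟨G, hG, hG'⟩ := step M le_rfl
  refine ⟨_, (hG.comp (Realizes.const (blockOp e' fun _ => D))), fun f => ?_⟩
  simp only [LinearIsometryEquiv.trans_apply]
  rw [hG', Fintype.sum_prod_type, Finset.sum_eq_single 0 (by intro c _ hc; simp [hc]) (by simp)]
  have hval : ∀ x : S × Y × K, blockOp e' (fun _ => D)
      (slotState (fun _ => a₀) fun c : Fin (M + 1) => (r : ℂ) • (U f)^[min M c] v₁) (0, x)
      = if x.1 = a₀ then ((1 / (M + 1) : ℝ) : ℂ) *
        (∑ t ∈ Finset.range (M + 1), (U f)^[t] v₁) x.2 else 0 := by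
    intro x
    have h1 := congrArg (fun φ : Amp (Fin (M + 1)) => φ 0) (fiber_blockOp e' (fun _ => D)
      (slotState (fun _ => a₀) fun c : Fin (M + 1) => (r : ℂ) • (U f)^[min M c] v₁) x)
    simp only [fiber_apply] at h1
    refine Eq.trans h1 ?_
    -- Preparing the clock and detecting it each give a factor `1/√(M+1)`; together they turn the
    -- sum into the average.
    rw [hD', ← hr2]
    by_cases hx : x.1 = a₀
    · rw [if_pos hx, Finset.sum_range]
      have : ∀ c : Fin (M + 1), min M c.val = c.val := fun c => min_eq_right (by omega)
      simp [e', slotState, hx, this, ← Finset.mul_sum, mul_assoc]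
    · simp [e', slotState, hx]
  simp only [hval, if_true]
  rw [Fintype.sum_prod_type, Finset.sum_eq_single a₀ (by intro c _ hc; simp [hc]) (by simp)]
  simp only [if_true, norm_mul, mul_pow, ← Finset.mul_sum]
  rw [← EuclideanSpace.norm_sq_eq, Complex.norm_real, Real.norm_eq_abs, sq_abs]
  change _ = (‖∑ t ∈ Finset.range (M + 1), (U f)^[t] v₁‖ / (M + 1)) ^ 2
  ring

end Clock

/-! ### Reversible adaptive queries -/

section Compute

variable {I A : Type} [Fintype I] [DecidableEq I] [Inhabited I] [Fintype A] [DecidableEq A]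
  [AddCommGroup A] {c : ℕ}

/-- Add `z` to the slot with number `i`. -/
def addSlot (i : ℕ) (z : A) (a : Fin c → A) : Fin c → A :=
  fun j => if j.val = i then a j + z else a j

/-- The answers to the first `i` of the adaptive queries `Q`. -/
def trace (f : I → A) (Q : ℕ → (Fin c → A) → I) : ℕ → (Fin c → A)
  | 0 => 0
  | i + 1 => addSlot i (f (Q i (trace f Q i))) (trace f Q i)

/-- The query with number `i` depends only on the answers to the earlier ones. -/
def IsAdaptive (Q : ℕ → (Fin c → A) → I) : Prop :=
  ∀ i a a', (∀ j : Fin c, j.val < i → a j = a' j) → Q i a = Q i a'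

theorem trace_apply_of_le (f : I → A) (Q : ℕ → (Fin c → A) → I) {i j : ℕ} (l : Fin c)
    (hl : l.val < i) (hij : i ≤ j) : trace f Q j l = trace f Q i l := by
  induction j, hij using Nat.le_induction with
  | base => rfl
  | succ j hj ih =>
    rw [trace, addSlot, if_neg (by omega), ih]

theorem trace_apply_of_ge (f : I → A) (Q : ℕ → (Fin c → A) → I) {i : ℕ} (l : Fin c)
    (hl : i ≤ l.val) : trace f Q i l = 0 := by
  induction i with
  | zero => rfl
  | succ i ih => rw [trace, addSlot, if_neg (by omega), ih (by omega)]

/-- The final record answers its own queries: slots filled from position `j` on cannot change query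
`j`. -/
theorem trace_eq {f : I → A} {Q : ℕ → (Fin c → A) → I} (hQ : IsAdaptive Q) (j : Fin c) :
    trace f Q c j = f (Q j (trace f Q c)) := by
  rw [trace_apply_of_le f Q (i := j + 1) j (by omega) (by omega), trace, addSlot, if_pos rfl,
    trace_apply_of_ge f Q j le_rfl, zero_add]
  congr 1
  exact hQ _ _ _ fun l hl => (trace_apply_of_le f Q l hl (by omega)).symm

variable {C Y K : Type} [Fintype C] [Fintype Y] [Fintype K]

/-- Add `z` to the slot with number `i`, as a permutation of basis states. -/
def addSlotPerm (i : ℕ) (z : A) : Equiv.Perm (C × (Fin c → A) × Y × K) where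
  toFun w := (w.1, addSlot i z w.2.1, w.2.2)
  invFun w := (w.1, addSlot i (-z) w.2.1, w.2.2)
  left_inv w := by
    refine Prod.ext rfl (Prod.ext ?_ rfl)
    funext j
    by_cases hj : j.val = i <;> simp [addSlot, hj]
  right_inv w := by
    refine Prod.ext rfl (Prod.ext ?_ rfl)
    funext j
    by_cases hj : j.val = i <;> simp [addSlot, hj]

/-- Adaptive classical queries can be made reversibly. -/
theorem exists_compute_perm (Q : Y → ℕ → (Fin c → A) → I) (hQ : ∀ y, IsAdaptive (Q y)) (i : ℕ) :
    ∃ V : (I → A) → Equiv.Perm (C × (Fin c → A) × Y × K),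
      (∀ f c y k, V f (c, 0, y, k) = (c, trace f (Q y) i, y, k)) ∧
      Realizes (2 * i) (fun f => permIso (V f)) ∧ Realizes (2 * i) fun f => permIso (V f)⁻¹ := by
  induction i with
  | zero =>
    refine ⟨fun _ => 1, fun f c y k => rfl, Realizes.const _, Realizes.const _⟩
  | succ i ih =>
    obtain ⟨V, hV, h, h'⟩ := ih
    let q : C × (Fin c → A) × Y × K → I := fun w => Q w.2.2.1 i w.2.1
    have hq : ∀ z w, q (addSlotPerm i z w) = q w := fun z w =>
      hQ _ _ _ _ fun j hj => if_neg hj.ne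
    have hq' : ∀ z w, q ((addSlotPerm i z)⁻¹ w) = q w := fun z w =>
      hQ _ _ _ _ fun j hj => if_neg hj.ne
    refine ⟨fun f => controlledPerm q (addSlotPerm i) hq f * V f, fun f c y k => ?_, ?_, ?_⟩
    · rw [Equiv.Perm.mul_apply, hV]
      rfl
    · exact (h.comp (Realizes.controlled q (addSlotPerm i) hq)).of_eq fun f ψ =>
        (permIso_mul _ _ _).symm
    · have := ((Realizes.controlled q (fun z => (addSlotPerm i z)⁻¹) hq').comp h').of_eq
        (G := fun f => permIso (controlledPerm q (addSlotPerm i) hq f * V f)⁻¹) fun f ψ => by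
          rw [mul_inv_rev, permIso_mul]
          rfl
      rwa [mul_add, mul_one, add_comm]

end Compute

/-! ### Vectors for the branches of a step -/

section Weights

variable {S : Type} [Fintype S] [DecidableEq S]

/-- The vector that represents a branch in positive witnesses; `none` is the predicted branch. -/
noncomputable def posVec (β : ℝ) (b : Option S) : Amp (Bool ⊕ Option S) :=
  WithLp.toLp 2 <| Sum.elim
    (fun x => if b = none then (if x then 0 else (β : ℂ)) else ((β⁻¹ : ℝ) : ℂ))
    (fun b' => if b' = b then (if b = none then (β : ℂ) else 1) else 0)

/-- The vector that represents a branch in negative witnesses. -/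
noncomputable def negVec (β : ℝ) (b : Option S) : Amp (Bool ⊕ Option S) :=
  WithLp.toLp 2 <| Sum.elim
    (fun x => if b = none then (if x then 0 else (β : ℂ))
      else (if x then ((β - β⁻¹ : ℝ) : ℂ) else ((β⁻¹ : ℝ) : ℂ)))
    (fun b' => if b' = b then (if b = none then -(β : ℂ) else -1) else 0)

/-- The two `Bool` coordinates pair to 1 for all pairs of branches, except that two predicted
branches give `β²`; the remaining coordinates subtract exactly the diagonal. The factors `β` and
`β⁻¹` cancel between a predicted and an unpredicted branch, so the former can be cheap if the latter
is expensive. -/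
theorem inner_posVec_negVec {β : ℝ} (hβ : β ≠ 0) (b b' : Option S) :
    inner ℂ (posVec β b) (negVec β b') = if b = b' then (0 : ℂ) else 1 := by
  have hβ' : (β : ℂ) ≠ 0 := by exact_mod_cast hβ
  have habs : ((|β| : ℝ) : ℂ) ^ 2 = (β : ℂ) ^ 2 := by
    rw [← Complex.ofReal_pow, sq_abs, Complex.ofReal_pow]
  rw [PiLp.inner_apply, Fintype.sum_sum_type, Fintype.sum_bool]
  have h : ∑ x : Option S, inner ℂ (posVec β b (Sum.inr x)) (negVec β b' (Sum.inr x))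
      = if b = b' then (if b = none then -(β : ℂ) * β else -1) else 0 := by
    rw [Finset.sum_eq_single b]
    · by_cases hb : b = b'
      · subst hb
        by_cases h0 : b = none <;> simp [posVec, negVec, h0]
      · simp [posVec, negVec, hb]
    · intro x _ hx; simp [posVec, hx]
    · simp
  rw [h]
  by_cases hb : b = b'
  · subst hb
    by_cases h0 : b = none
    · simp [posVec, negVec, h0, habs]
      ring
    · simp [posVec, negVec, h0, habs]
      field_simp
      ring
  · by_cases h0 : b = none <;> by_cases h1 : b' = none
    · exact absurd (h0.trans h1.symm) hb
    · simp [posVec, negVec, h0, h1, Ne.symm h1, hβ']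
    · simp [posVec, negVec, h0, h1, hβ']
    · simp [posVec, negVec, h0, h1, hb, habs]
      field_simp
      ring

/-- A bound on the squared norms of the vectors of a branch. -/
noncomputable def branchCost (β : ℝ) (b : Option S) : ℝ :=
  if b = none then 2 * β ^ 2 else 3 * (β ^ 2)⁻¹

theorem norm_posVec_sq_le {β : ℝ} (h0 : 0 < β) (h1 : β ≤ 1) (b : Option S) :
    ‖posVec β b‖ ^ 2 ≤ branchCost β b := by
  rw [EuclideanSpace.norm_sq_eq, Fintype.sum_sum_type, Fintype.sum_bool, Finset.sum_eq_single b]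
  · by_cases hb : b = none
    · simp [posVec, branchCost, hb]
      linarith
    -- As `β ≤ 1`, the coordinate 1 is absorbed into a third copy of `β⁻²`.
    · have : 1 ≤ (β ^ 2)⁻¹ := (one_le_inv₀ (by positivity)).2 (by nlinarith)
      simp [posVec, branchCost, hb]
      linarith
  · intro x _ hx; simp [posVec, hx]
  · simp

theorem norm_negVec_sq_le {β : ℝ} (h0 : 0 < β) (h1 : β ≤ 1) (b : Option S) :
    ‖negVec β b‖ ^ 2 ≤ branchCost β b := by
  rw [EuclideanSpace.norm_sq_eq, Fintype.sum_sum_type, Fintype.sum_bool, Finset.sum_eq_single b]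
  · by_cases hb : b = none
    · simp [negVec, branchCost, hb]
      linarith
    · have h2 : 1 ≤ (β ^ 2)⁻¹ := (one_le_inv₀ (by positivity)).2 (by nlinarith)
      have h3 : ‖((β - β⁻¹ : ℝ) : ℂ)‖ ^ 2 = β ^ 2 - 2 + (β ^ 2)⁻¹ := by
        rw [Complex.norm_real, Real.norm_eq_abs, sq_abs]
        field_simp
        ring
      have h4 : ‖((β⁻¹ : ℝ) : ℂ)‖ ^ 2 = (β ^ 2)⁻¹ := by
        rw [Complex.norm_real, Real.norm_eq_abs, sq_abs, inv_pow]
      simp only [negVec, branchCost, hb, Sum.elim_inl, Sum.elim_inr, if_true, if_false,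
        Bool.false_eq_true, h3, h4, norm_neg, norm_one]
      nlinarith
  · intro x _ hx; simp [negVec, hx]
  · simp

end Weights

/-! ### From classical prediction to quantum speed-up -/

/-- A classical query algorithm with predictions. In every step it makes `c` adaptive queries, maps
the answers to a branch, where `none` stands for the predicted one, and updates its state according
to the branch. -/
structure GuessingMachine (I A : Type) (c : ℕ) where
  /-- the states -/
  State : Type
  /-- the initial state -/
  start : State
  /-- the queries made in a state -/
  query : State → ℕ → (Fin c → A) → I
  /-- the branch determined by the answers -/
  branch : State → (Fin c → A) → Option (Fin c → A)
  /-- the transition -/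
  next : State → Option (Fin c → A) → State
  /-- the output in a final state -/
  out : State → Bool

namespace GuessingMachine

variable {I A : Type} [AddCommGroup A] {c : ℕ} (𝓜 : GuessingMachine I A c)

/-- The branch taken in a state on the input `f`. -/
def branchAt (f : I → A) (s : 𝓜.State) : Option (Fin c → A) :=
  𝓜.branch s (trace f (𝓜.query s) c)

/-- The state after `t` steps on the input `f`. -/
def run (f : I → A) : ℕ → 𝓜.State
  | 0 => 𝓜.start
  | t + 1 => 𝓜.next (run f t) (𝓜.branchAt f (run f t))

/-- The number of wrong predictions in the first `T` steps. -/
def mistakes (f : I → A) (T : ℕ) : ℕ :=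
  ((Finset.range T).filter fun t => 𝓜.branchAt f (𝓜.run f t) ≠ none).card

/-- The state after a sequence of branches, latest first. -/
def stateOf : List (Option (Fin c → A)) → 𝓜.State
  | [] => 𝓜.start
  | b :: l => 𝓜.next (stateOf l) b

/-- The branches taken in the first `t` steps on the input `f`, latest first. -/
def hist (f : I → A) : ℕ → List (Option (Fin c → A))
  | 0 => []
  | t + 1 => 𝓜.branchAt f (𝓜.run f t) :: hist f t

theorem stateOf_hist (f : I → A) (t : ℕ) : 𝓜.stateOf (𝓜.hist f t) = 𝓜.run f t := by
  induction t with
  | zero => rfl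
  | succ t ih => rw [hist, stateOf, ih]; rfl

theorem length_hist (f : I → A) (t : ℕ) : (𝓜.hist f t).length = t := by
  induction t with
  | zero => rfl
  | succ t ih => rw [hist, List.length_cons, ih]

/-- The nodes of the decision tree of depth `T`. -/
abbrev Node (A : Type) (c T : ℕ) : Type := {l : List (Option (Fin c → A)) // l.length < T}

noncomputable instance [Finite A] (T : ℕ) : Fintype (Node A c T) :=
  (List.finite_length_lt _ T).fintype

variable [Fintype A] [DecidableEq A]

/-- The path of `f` meets every level below `T` in exactly one node. -/
theorem sum_hist {R : Type} [AddCommMonoid R] (f : I → A) (T : ℕ) (g : ℕ → R) :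
    ∑ l : Node A c T, (if l.1 = 𝓜.hist f l.1.length then g l.1.length else 0)
      = ∑ t ∈ Finset.range T, g t := by
  rw [← Finset.sum_filter]
  refine Finset.sum_bij' (fun l _ => l.1.length)
    (fun t ht => ⟨𝓜.hist f t, by rw [length_hist]; exact Finset.mem_range.1 ht⟩) ?_ ?_ ?_ ?_ ?_
  · intro l _; exact Finset.mem_range.2 l.2
  · intro t _; simp [length_hist]
  · intro l hl; exact Subtype.ext (Finset.mem_filter.1 hl).2.symm
  · intro t _; exact 𝓜.length_hist f t
  · intro l _; rfl

/-- The superposition of the path of the input `f` in the decision tree, with vectors `u` for the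
branches, and of an extra basis state. -/
noncomputable def pathState (T : ℕ) (u : Option (Fin c → A) → Amp (Bool ⊕ Option (Fin c → A)))
    (κ : ℂ) (f : I → A) : Amp (Option (Node A c T) × (Bool ⊕ Option (Fin c → A))) :=
  WithLp.toLp 2 fun w => w.1.elim (EuclideanSpace.single (Sum.inl false) (1 : ℂ) w.2) fun l =>
    if l.1 = 𝓜.hist f l.1.length then κ * u (𝓜.branchAt f (𝓜.run f l.1.length)) w.2 else 0

variable {T : ℕ} (u v : Option (Fin c → A) → Amp (Bool ⊕ Option (Fin c → A))) (κ μ : ℂ)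
  (f g : I → A)

theorem fiber_pathState_none :
    fiber (Equiv.refl _) (𝓜.pathState T u κ f) none = EuclideanSpace.single (Sum.inl false) 1 := rfl

theorem fiber_pathState_some (l : Node A c T) :
    fiber (Equiv.refl _) (𝓜.pathState T u κ f) (some l)
      = (if l.1 = 𝓜.hist f l.1.length then κ else 0)
        • u (𝓜.branchAt f (𝓜.run f l.1.length)) := by
  ext k
  simp only [fiber_apply, pathState, Equiv.refl_symm, Equiv.refl_apply, Option.elim,
    PiLp.smul_apply, smul_eq_mul]
  split_ifs <;> simp

theorem norm_pathState_sq :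
    ‖𝓜.pathState T u κ f‖ ^ 2
      = 1 + ‖κ‖ ^ 2 * ∑ t ∈ Finset.range T, ‖u (𝓜.branchAt f (𝓜.run f t))‖ ^ 2 := by
  rw [norm_sq_eq_sum_fiber (Equiv.refl _), Fintype.sum_option, fiber_pathState_none,
    Finset.mul_sum, ← 𝓜.sum_hist f]
  congr 1
  · simp
  · refine Finset.sum_congr rfl fun l _ => ?_
    rw [fiber_pathState_some, norm_smul, mul_pow]
    split_ifs <;> simp

/-- Different paths part at exactly one node, which contributes `κ̄μ = −1`. Shared nodes above it
contribute 0 because the branches agree, none below it is shared, and the extra basis state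
contributes 1. -/
theorem inner_pathState (huv : ∀ b b', inner ℂ (u b) (v b') = if b = b' then (0 : ℂ) else 1)
    (hκ : (starRingEnd ℂ) κ * μ = -1) (h : 𝓜.hist f T ≠ 𝓜.hist g T) :
    inner ℂ (𝓜.pathState T u κ f) (𝓜.pathState T v μ g) = 0 := by
  -- Level `t` contributes the change of the indicator that the histories agree, so the levels
  -- telescope to −1.
  have key : ∀ t, (if 𝓜.hist f t = 𝓜.hist g t then
      (if 𝓜.branchAt f (𝓜.run f t) = 𝓜.branchAt g (𝓜.run g t) then (0 : ℂ) else -1) else 0)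
      = (if 𝓜.hist f (t + 1) = 𝓜.hist g (t + 1) then 1 else 0)
        - if 𝓜.hist f t = 𝓜.hist g t then 1 else 0 := by
    intro t
    simp only [hist, List.cons.injEq]
    by_cases h1 : 𝓜.hist f t = 𝓜.hist g t <;>
      by_cases h2 : 𝓜.branchAt f (𝓜.run f t) = 𝓜.branchAt g (𝓜.run g t) <;> simp [h1, h2]
  have hsum := 𝓜.sum_hist f T fun t => (if 𝓜.hist f t = 𝓜.hist g t then
      (if 𝓜.branchAt f (𝓜.run f t) = 𝓜.branchAt g (𝓜.run g t) then (0 : ℂ) else -1) else 0)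
  rw [Finset.sum_congr rfl fun t _ => key t,
    Finset.sum_range_sub fun t => if 𝓜.hist f t = 𝓜.hist g t then (1 : ℂ) else 0,
    if_neg h] at hsum
  rw [inner_eq_sum_fiber (Equiv.refl _), Fintype.sum_option, fiber_pathState_none,
    fiber_pathState_none]
  have h1 : ∀ l : Node A c T, inner ℂ (fiber (Equiv.refl _) (𝓜.pathState T u κ f) (some l))
      (fiber (Equiv.refl _) (𝓜.pathState T v μ g) (some l))
      = if l.1 = 𝓜.hist f l.1.length then (if 𝓜.hist f l.1.length = 𝓜.hist g l.1.length then
        (if 𝓜.branchAt f (𝓜.run f l.1.length) = 𝓜.branchAt g (𝓜.run g l.1.length) then (0 : ℂ)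
          else -1) else 0) else 0 := by
    intro l
    rw [fiber_pathState_some, fiber_pathState_some, inner_smul_left, inner_smul_right, huv]
    by_cases h1 : l.1 = 𝓜.hist f l.1.length
    · rw [if_pos h1, if_pos h1, ← h1, ← mul_assoc]
      by_cases h2 : l.1 = 𝓜.hist g l.1.length
      · rw [if_pos h2, if_pos h2, hκ]
        split_ifs <;> simp
      · rw [if_neg h2, if_neg h2]; simp
    · rw [if_neg h1, if_neg h1]; simp
  rw [Finset.sum_congr rfl fun l _ => h1 l, hsum]
  simp [hist]

theorem sum_branchCost_le {R : ℕ} (β : ℝ) (h : 𝓜.mistakes f T ≤ R) :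
    ∑ t ∈ Finset.range T, branchCost β (𝓜.branchAt f (𝓜.run f t))
      ≤ T * (2 * β ^ 2) + R * (3 * (β ^ 2)⁻¹) := by
  have h1 : ∀ t, branchCost β (𝓜.branchAt f (𝓜.run f t))
      ≤ 2 * β ^ 2 + if 𝓜.branchAt f (𝓜.run f t) ≠ none then 3 * (β ^ 2)⁻¹ else 0 := by
    intro t
    unfold branchCost
    by_cases h : 𝓜.branchAt f (𝓜.run f t) = none
    · simp [h]
    · rw [if_neg h, if_pos h]
      nlinarith [sq_nonneg β]
  refine (Finset.sum_le_sum fun t _ => h1 t).trans ?_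
  rw [Finset.sum_add_distrib, Finset.sum_const, Finset.card_range, nsmul_eq_mul,
    ← Finset.sum_filter, Finset.sum_const, nsmul_eq_mul]
  have h2 : (((Finset.range T).filter fun t => 𝓜.branchAt f (𝓜.run f t) ≠ none).card : ℝ) ≤ R := by
    exact_mod_cast h
  have h3 : 0 ≤ 3 * (β ^ 2)⁻¹ := by positivity
  nlinarith

variable [Fintype I] [DecidableEq I] [Inhabited I]

/-- Classical query algorithms that make at most `R` wrong predictions in `T` steps have quantum
counterparts with `O(√(RT))` queries. -/
theorem exists_queryAlgorithm (hQ : ∀ s, IsAdaptive (𝓜.query s)) {T R : ℕ} (hR : 1 ≤ R)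
    (hRT : R ≤ T) (k : ℕ) :
    ∃ 𝒜 : QueryAlgorithm I A, 𝒜.queries = 4 * c * ⌈85 * √((R : ℝ) * T)⌉₊ * k ∧
      ∀ f, 𝓜.mistakes f T ≤ R → 𝒜.prob f (!(𝓜.out (𝓜.run f T))) ≤ (1 / 2) ^ k := by
  classical
  -- `W` will be the total branch cost of a path, and `85 = 17 · 5` makes the clock at least `17W`
  -- long.
  set M := ⌈85 * √((R : ℝ) * T)⌉₊ with hM
  set W : ℝ := 5 * √((R : ℝ) * T) with hW
  have hR' : (1 : ℝ) ≤ R := by exact_mod_cast hR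
  have hRT' : (R : ℝ) ≤ T := by exact_mod_cast hRT
  have hW5 : 5 ≤ W := by
    have : 1 ≤ √((R : ℝ) * T) := Real.one_le_sqrt.2 (by nlinarith)
    linarith
  have hMW : 17 * W ≤ M + 1 := by
    have := Nat.le_ceil (85 * √((R : ℝ) * T))
    rw [← hM] at this
    linarith
  -- `β² = √(R/T)` balances the two costs, which become `2√(RT)` and `3√(RT)`.
  obtain ⟨β, hβ0, hβ1, hβW⟩ : ∃ β : ℝ, 0 < β ∧ β ≤ 1 ∧
      T * (2 * β ^ 2) + R * (3 * (β ^ 2)⁻¹) = W := by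
    have hs : 0 < √(R : ℝ) := Real.sqrt_pos.2 (by linarith)
    have ht : 0 < √(T : ℝ) := Real.sqrt_pos.2 (by linarith)
    refine ⟨√(√R / √T), Real.sqrt_pos.2 (by positivity), ?_, ?_⟩
    · rw [Real.sqrt_le_one, div_le_one ht]
      exact Real.sqrt_le_sqrt hRT'
    · rw [Real.sq_sqrt (by positivity), inv_div, hW, Real.sqrt_mul (by linarith)]
      have h1 : (T : ℝ) * (2 * (√R / √T)) = 2 * (√R * √T) := by
        have : (T : ℝ) / √T = √T := Real.div_sqrt
        calc (T : ℝ) * (2 * (√R / √T)) = 2 * (√R * (T / √T)) := by ring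
          _ = _ := by rw [this]
      have h2 : (R : ℝ) * (3 * (√T / √R)) = 3 * (√R * √T) := by
        have : (R : ℝ) / √R = √R := Real.div_sqrt
        calc (R : ℝ) * (3 * (√T / √R)) = 3 * (R / √R * √T) := by ring
          _ = _ := by rw [this]
      rw [h1, h2]; ring
  have hcost : ∀ f, 𝓜.mistakes f T ≤ R →
      ∑ t ∈ Finset.range T, branchCost β (𝓜.branchAt f (𝓜.run f t)) ≤ W := fun f hf =>
    (𝓜.sum_branchCost_le f β hf).trans_eq hβW
  -- Scaling by `−κ` and `κ⁻¹` keeps the product −1 and shifts the cost to the negative side: the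
  -- positive squared norm is at most `1 + 1/16`, the negative one at most `1 + 16W² ≤ 17W²`.
  set κ : ℝ := 1 / (4 * √W) with hκ
  have hsW : 0 < √W := Real.sqrt_pos.2 (by linarith)
  have hκ0 : 0 < κ := by positivity
  have hκ2 : κ ^ 2 = 1 / (16 * W) := by
    rw [hκ, div_pow, mul_pow, Real.sq_sqrt (by linarith)]; norm_num
  let pos := fun f => 𝓜.pathState T (posVec β) (-κ : ℂ) f
  let neg := fun f => 𝓜.pathState T (negVec β) (κ⁻¹ : ℂ) f
  have hpos : ∀ f, 𝓜.mistakes f T ≤ R → ‖pos f‖ ^ 2 ≤ 17 / 16 := by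
    intro f hf
    simp only [pos]
    rw [norm_pathState_sq]
    have h1 : ‖(-κ : ℂ)‖ ^ 2 = 1 / (16 * W) := by
      rw [norm_neg, Complex.norm_real, Real.norm_eq_abs, sq_abs, hκ2]
    rw [h1]
    have h2 := (Finset.sum_le_sum fun t (_ : t ∈ Finset.range T) =>
      norm_posVec_sq_le hβ0 hβ1 (𝓜.branchAt f (𝓜.run f t))).trans (hcost f hf)
    have h3 : 1 / (16 * W) * ∑ t ∈ Finset.range T, ‖posVec β (𝓜.branchAt f (𝓜.run f t))‖ ^ 2
        ≤ 1 / (16 * W) * W := mul_le_mul_of_nonneg_left h2 (by positivity)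
    have h4 : 1 / (16 * W) * W = 1 / 16 := by field_simp
    linarith
  have hneg : ∀ f, 𝓜.mistakes f T ≤ R → ‖neg f‖ ^ 2 ≤ 17 * W ^ 2 := by
    intro f hf
    simp only [neg]
    rw [norm_pathState_sq]
    have h1 : ‖(κ⁻¹ : ℂ)‖ ^ 2 = 16 * W := by
      rw [norm_inv, Complex.norm_real, Real.norm_eq_abs, inv_pow, sq_abs, hκ2]
      simp
    rw [h1]
    have h2 := (Finset.sum_le_sum fun t (_ : t ∈ Finset.range T) =>
      norm_negVec_sq_le hβ0 hβ1 (𝓜.branchAt f (𝓜.run f t))).trans (hcost f hf)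
    nlinarith
  let Q : Option (Node A c T) → ℕ → (Fin c → A) → I := fun y =>
    y.elim (fun _ _ => default) fun l => 𝓜.query (𝓜.stateOf l.1)
  have hQ' : ∀ y, IsAdaptive (Q y) := by
    rintro (_ | l)
    · intro i a a' _; rfl
    · exact hQ _
  let L : (Fin c → A) → Option (Node A c T) → Amp (Bool ⊕ Option (Fin c → A)) ≃ₗᵢ[ℂ]
      Amp (Bool ⊕ Option (Fin c → A)) := fun a y =>
    (ℂ ∙ y.elim (EuclideanSpace.single (Sum.inl false) (1 : ℂ)) fun l =>
      posVec β (𝓜.branch (𝓜.stateOf l.1) a)).reflection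
  -- Inputs with many mistakes are included; the bound on mistakes enters only through the norms of
  -- the vectors of the actual input.
  let N : Submodule ℂ (Amp (Option (Node A c T) × (Bool ⊕ Option (Fin c → A)))) :=
    Submodule.span ℂ (neg '' {g | 𝓜.out (𝓜.run g T) = false})
  let w₀ : Option (Node A c T) × (Bool ⊕ Option (Fin c → A)) := (none, Sum.inl false)
  obtain ⟨V, hV, hV1, hV2⟩ := exists_compute_perm (C := Fin (M + 1))
    (K := Bool ⊕ Option (Fin c → A)) Q hQ' c
  obtain ⟨G, hG, hG'⟩ := Realizes.average hV hV1 hV2 L Nᗮ.reflection w₀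
  have hbranch : ∀ f (l : Node A c T), l.1 = 𝓜.hist f l.1.length →
      𝓜.branch (𝓜.stateOf l.1) (trace f (Q (some l)) c)
        = 𝓜.branchAt f (𝓜.run f l.1.length) := by
    intro f l hl
    have : 𝓜.stateOf l.1 = 𝓜.run f l.1.length := by
      rw [← stateOf_hist, ← hl]
    simp only [Q, Option.elim]
    rw [this]
    rfl
  have hfix : ∀ f, blockOp (Equiv.refl _) (fun y => L (trace f (Q y) c) y) (pos f) = pos f := by
    intro f
    refine fiber_ext (Equiv.refl _) fun y => ?_
    rw [fiber_blockOp]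
    apply Submodule.reflection_mem_subspace_eq_self
    rcases y with _ | l
    · exact Submodule.mem_span_singleton_self _
    · simp only [pos]
      rw [fiber_pathState_some]
      by_cases hl : l.1 = 𝓜.hist f l.1.length
      · rw [← hbranch f l hl]
        exact Submodule.smul_mem _ _ (Submodule.mem_span_singleton_self _)
      · rw [if_neg hl, zero_smul]
        exact Submodule.zero_mem _
  -- At tree nodes the negative vector is orthogonal to the line of reflection, hence negated. Its
  -- component at the extra state is fixed, which accounts for twice that state.
  have hflip : ∀ f, blockOp (Equiv.refl _) (fun y => L (trace f (Q y) c) y) (neg f)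
      = (2 : ℂ) • basisState w₀ - neg f := by
    intro f
    refine fiber_ext (Equiv.refl _) fun y => ?_
    rw [fiber_blockOp]
    rcases y with _ | l
    · have h1 : fiber (Equiv.refl _) (neg f) none = EuclideanSpace.single (Sum.inl false) 1 := rfl
      rw [h1]
      refine (Submodule.reflection_mem_subspace_eq_self
        (Submodule.mem_span_singleton_self _)).trans ?_
      ext k
      have h2 : neg f (none, k) = EuclideanSpace.single (Sum.inl false) (1 : ℂ) k := rfl
      rw [fiber_apply, PiLp.sub_apply, Equiv.refl_symm, Equiv.refl_apply, h2]
      by_cases hk : k = Sum.inl false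
      · simp [w₀, basisState_eq, hk]; norm_num
      · simp [w₀, basisState_eq, hk]
    · have h1 : fiber (Equiv.refl _) ((2 : ℂ) • basisState w₀ - neg f) (some l)
          = -fiber (Equiv.refl _) (neg f) (some l) := by
        ext k; simp [w₀, basisState_eq]
      rw [h1]
      apply Submodule.reflection_mem_subspace_orthogonalComplement_eq_neg
      rw [Submodule.mem_orthogonal_singleton_iff_inner_right]
      simp only [neg]
      rw [fiber_pathState_some, inner_smul_right]
      by_cases hl : l.1 = 𝓜.hist f l.1.length
      · rw [← hbranch f l hl]
        simp only [Option.elim]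
        rw [inner_posVec_negVec hβ0.ne', if_pos rfl, mul_zero]
      · rw [if_neg hl, zero_mul]
  obtain ⟨𝒜, h𝒜, h𝒜'⟩ := hG.exists_majority_algorithm ((0 : Fin (M + 1)), (0 : Fin c → A), w₀)
    (fun w => decide (w.1 = 0)) k
  refine ⟨𝒜, by rw [h𝒜]; ring, fun f hf => h𝒜' f _ ?_⟩
  set α := ∑ w, (if w.1 = 0 then
    ‖G f (basisState ((0 : Fin (M + 1)), (0 : Fin c → A), w₀)) w‖ ^ 2 else 0) with hα
  have hαf := hα.trans (hG' f)
  set U := Nᗮ.reflection.trans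
    (blockOp (Equiv.refl _) fun y => L (trace f (Q y) c) y)
  set B := ‖∑ t ∈ Finset.range (M + 1), U^[t] (basisState w₀)‖
  have hM0 : (0 : ℝ) < M + 1 := by positivity
  cases hout : 𝓜.out (𝓜.run f T)
  · have hU : U (neg f) = neg f - (2 : ℂ) • basisState w₀ := by
      have h1 : Nᗮ.reflection (neg f) = -neg f := by
        apply Submodule.reflection_mem_subspace_orthogonal_precomplement_eq_neg
        exact Submodule.subset_span ⟨f, hout, rfl⟩
      simp only [U, LinearIsometryEquiv.trans_apply]
      rw [h1, map_neg, hflip, neg_sub]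
    have hB : B ≤ ‖neg f‖ := norm_sum_iterate_le hU _
    have hB2 : B ^ 2 ≤ 17 * W ^ 2 := (pow_le_pow_left₀ (norm_nonneg _) hB 2).trans (hneg f hf)
    -- The ratio is at most `17W² / (17W)² = 1/17`.
    have : α ≤ 1 / 16 := by
      rw [hαf, div_pow, div_le_iff₀ (by positivity)]
      nlinarith
    simpa [hα] using this
  · have hU : U (pos f) = pos f := by
      have h1 : Nᗮ.reflection (pos f) = pos f := by
        apply Submodule.reflection_mem_subspace_eq_self
        rw [Submodule.mem_orthogonal']
        intro x hx
        induction hx using Submodule.span_induction with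
        | mem x hx =>
          obtain ⟨g, hg, rfl⟩ := hx
          apply inner_pathState
          · exact fun b b' => inner_posVec_negVec hβ0.ne' b b'
          · rw [map_neg, Complex.conj_ofReal, neg_mul, mul_inv_cancel₀]
            exact_mod_cast hκ0.ne'
          · intro hc
            have h2 : 𝓜.run f T = 𝓜.run g T := by rw [← stateOf_hist, hc, stateOf_hist]
            rw [h2, hg] at hout
            exact Bool.noConfusion hout
        | zero => exact inner_zero_right _
        | add x y _ _ hx hy => rw [inner_add_right, hx, hy, add_zero]
        | smul a x _ hx => rw [inner_smul_right, hx, mul_zero]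
      simp only [U, LinearIsometryEquiv.trans_apply]
      rw [h1, hfix]
    have hinner : inner ℂ (pos f) (basisState w₀) = (1 : ℂ) := by
      rw [basisState_eq, EuclideanSpace.inner_single_right]
      simp [pos, pathState, w₀]
    have hB := one_le_norm_mul_norm_sum_iterate hU hinner (M + 1)
    change ((M + 1 : ℕ) : ℝ) ≤ ‖pos f‖ * B at hB
    push_cast at hB
    -- A squared norm of at most `17/16` gives acceptance with probability at least `16/17`.
    have hα2 : 15 / 16 ≤ α := by
      rw [hαf, div_pow, le_div_iff₀ (by positivity)]
      have h1 : (M + 1 : ℝ) ^ 2 ≤ ‖pos f‖ ^ 2 * B ^ 2 := by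
        rw [← mul_pow]; exact pow_le_pow_left₀ hM0.le hB 2
      have h2 : ‖pos f‖ ^ 2 * B ^ 2 ≤ 17 / 16 * B ^ 2 :=
        mul_le_mul_of_nonneg_right (hpos f hf) (sq_nonneg _)
      nlinarith
    have htot : ∑ w, ‖G f (basisState ((0 : Fin (M + 1)), (0 : Fin c → A), w₀)) w‖ ^ 2
        = 1 := by
      rw [← EuclideanSpace.norm_sq_eq, LinearIsometryEquiv.norm_map, basisState_eq]; simp
    have hsplit : ∀ w : Fin (M + 1) × (Fin c → A) × Option (Node A c T) ×
        (Bool ⊕ Option (Fin c → A)), (if decide (w.1 = 0) = !true then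
        ‖G f (basisState ((0 : Fin (M + 1)), (0 : Fin c → A), w₀)) w‖ ^ 2 else 0)
        = ‖G f (basisState ((0 : Fin (M + 1)), (0 : Fin c → A), w₀)) w‖ ^ 2
          - if w.1 = 0 then
        ‖G f (basisState ((0 : Fin (M + 1)), (0 : Fin c → A), w₀)) w‖ ^ 2 else 0 := by
      intro w
      by_cases hw : w.1 = 0 <;> simp [hw]
    rw [Finset.sum_congr rfl fun w _ => hsplit w, Finset.sum_sub_distrib, htot, ← hα]
    linarith

end GuessingMachine

/-! ### Structure of circuits -/

/-- A gate can be fed one argument at a time, so the search needs to store only a single accumulated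
bit per vertex. -/
theorem Gate.eval_append_singleton (g : Gate) (l : List Bool) (b : Bool) :
    g.eval (l ++ [b]) = g.eval [g.eval l, b] := by
  cases g
  · simp [Gate.eval]
  · simp [Gate.eval]
  · simp only [Gate.eval]
    induction l with
    | nil => simp
    | cons a l ih => simp [ih]

namespace CircuitDag

variable {n N : ℕ} (G : CircuitDag n N)

/-- The number of proper descendants drops along an edge: those of `j` are among those of `i`, while
`j` itself is one of `i` but not of `j`. -/
theorem exists_rank : ∃ r : Fin n → ℕ, ∀ i, ∀ j ∈ G.out i, r j < r i := by
  classical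
  let D : Fin n → Finset (Fin n) := fun i =>
    Finset.univ.filter fun j => Relation.TransGen (fun a b => b ∈ G.out a) i j
  refine ⟨fun i => (D i).card, fun i j hj => Finset.card_lt_card ?_⟩
  rw [Finset.ssubset_iff_of_subset]
  · exact ⟨j, by simpa [D] using Relation.TransGen.single hj, by simpa [D] using G.acyclic j⟩
  · intro k hk
    simp only [D, Finset.mem_filter, Finset.mem_univ, true_and] at hk ⊢
    exact Relation.TransGen.head hj hk

/-- The adjacency lists, with an extra vertex `none` above the root. -/
def args : Option (Fin n) → List (Fin n)
  | none => [G.root]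
  | some i => G.out i

/-- The gates, where the extra vertex is an AND. -/
def gate : Option (Fin n) → Gate
  | none => .and
  | some i => G.op i

/-- The sign of an edge, where the edge to the root is positive. -/
def edgeSign : Option (Fin n) → Fin n → Bool
  | none, _ => true
  | some i, j => G.sign i j

variable (x : Fin N → Bool)

/-- The literal at the end of an edge. -/
noncomputable def literal (v : Option (Fin n)) (j : Fin n) : Bool := G.value x j == G.edgeSign v j

/-- The values of the vertices, where the extra vertex has the value of the circuit. -/
noncomputable def extValue : Option (Fin n) → Bool
  | none => G.eval x
  | some i => G.value x i

theorem extValue_eq {v : Option (Fin n)} (hv : G.args v ≠ []) :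
    G.extValue x v = (G.gate v).eval ((G.args v).map (G.literal x v)) := by
  rcases v with _ | i
  · simp [extValue, gate, args, literal, edgeSign, Gate.eval, CircuitDag.eval]
  · have hv' : G.out i ≠ [] := hv
    simp only [extValue, gate, args]
    rw [G.value_eq, if_neg hv']
    congr 1
    apply List.map_congr_left
    intro j _
    simp only [literal, edgeSign]
    cases G.sign i j <;> simp

/-- With out-degree one excluded, every non-sink has at least two edges. This is what makes the
number of steps linear in the number of edges alone. -/
theorem numNonSinks_mul_two_le : 2 * G.numNonSinks ≤ G.numEdges := by
  unfold numNonSinks numEdges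
  rw [mul_comm, ← smul_eq_mul, ← Finset.sum_const]
  refine (Finset.sum_le_sum fun i hi => ?_).trans
    (Finset.sum_le_sum_of_subset (Finset.filter_subset _ _))
  have h0 : (G.out i).length ≠ 0 := by
    simpa [List.length_eq_zero_iff] using (Finset.mem_filter.1 hi).2
  have h1 := G.degree_ne_one i
  omega

end CircuitDag

/-! ### Depth-first evaluation and its potentials -/

namespace CircuitSearch

/-- What is known about a vertex during the evaluation of a circuit. -/
inductive Status where
  | fresh
  | active (op : Gate) (deg pos : ℕ) (acc : Bool)
  | done (b : Bool)

/-- A state of the evaluation of a circuit by depth-first search. -/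
structure SearchState (n : ℕ) where
  /-- what is known about the vertices; `none` is an extra vertex above the root -/
  status : Option (Fin n) → Status
  /-- the vertices that are being evaluated, the deepest one first -/
  stack : List (Option (Fin n))

/-- What is read about an edge and its end. -/
structure EdgeData (n : ℕ) where
  /-- the end of the edge -/
  target : Fin n
  /-- the out-degree of the end -/
  deg : ℕ
  /-- the label of the end -/
  op : Gate
  /-- the sign of the edge -/
  sgn : Bool
  /-- the value of the end, if it is a sink -/
  leaf : Bool

variable {n N : ℕ}

/-- The literal at the end of an edge, if it is known. -/
def EdgeData.lit (d : EdgeData n) (st : Option (Fin n) → Status) : Option Bool :=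
  if d.deg = 0 then some (d.leaf == d.sgn) else
    match st (some d.target) with
    | .done b => some (b == d.sgn)
    | _ => none

/-- Process an argument of the deepest vertex. -/
def advance (s : SearchState n) (v : Option (Fin n)) (rest : List (Option (Fin n))) (b : Bool) :
    SearchState n :=
  match s.status v with
  | .active op deg pos acc =>
    if pos + 1 = deg ∨ (op = .and ∧ b = false) then
      ⟨Function.update s.status v (.done (op.eval [acc, b])), rest⟩
    else ⟨Function.update s.status v (.active op deg (pos + 1) (op.eval [acc, b])), v :: rest⟩
  | _ => s

/-- Start with the evaluation of a vertex. -/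
def descend (s : SearchState n) (d : EdgeData n) : SearchState n :=
  ⟨Function.update s.status (some d.target) (.active d.op d.deg 0 (d.op.eval [])),
    some d.target :: s.stack⟩

/-- A step of the search. -/
def step (s : SearchState n) (v : Option (Fin n)) (rest : List (Option (Fin n)))
    (d : EdgeData n) : SearchState n :=
  match d.lit s.status with
  | some b => advance s v rest b
  | none => descend s d

/-- The position in the adjacency list of a vertex. -/
def Status.pos : Status → ℕ
  | .active _ _ p _ => p
  | _ => 0

section Correctness

variable (G : CircuitDag n N) (x : Fin N → Bool)

/-- The data of an edge that starts at `v` are correct. -/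
structure EdgeData.Correct (d : EdgeData n) (v : Option (Fin n)) : Prop where
  deg_eq : d.deg = (G.out d.target).length
  op_eq : d.op = G.op d.target
  sgn_eq : d.sgn = G.edgeSign v d.target
  leaf_eq : d.deg = 0 → d.leaf = G.value x d.target

/-- The invariant of the search. -/
structure Invariant (r : Option (Fin n) → ℕ) (s : SearchState n) : Prop where
  done_eq : ∀ v b, s.status v = .done b → b = G.extValue x v
  mem_stack : ∀ v, v ∈ s.stack ↔ ∃ op d p a, s.status v = .active op d p a
  active_eq : ∀ v op d p a, s.status v = .active op d p a →
    op = G.gate v ∧ d = (G.args v).length ∧ p < d ∧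
      a = (G.gate v).eval (((G.args v).take p).map (G.literal x v)) ∧ (G.gate v = .and → a = true)
  sorted : s.stack.Pairwise fun u v => r u < r v
  none_ne : s.status none ≠ .fresh

/-- A bound on the number of steps that a vertex can still cause. -/
def steps (v : Option (Fin n)) : Status → ℕ
  | .fresh => if G.args v = [] then 0 else (G.args v).length + 1
  | .active _ d p _ => d - p
  | .done _ => 0

/-- A bound on the number of wrong predictions that a vertex can still cause. -/
def faults (v : Option (Fin n)) : Status → ℕ
  | .fresh => if G.args v = [] then 0 else 3
  | .active op d p _ => if op = .and then 1 else d - p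
  | .done _ => 0

/-- Both potentials are sums over vertices, and a search step changes a single status; the additive
form avoids subtraction in `ℕ`. -/
theorem sum_update_add (φ : Option (Fin n) → Status → ℕ) (st : Option (Fin n) → Status)
    (u : Option (Fin n)) (y : Status) :
    ∑ w, φ w (Function.update st u y w) + φ u (st u) = ∑ w, φ w (st w) + φ u y := by
  rw [← Finset.add_sum_erase _ _ (Finset.mem_univ u),
    ← Finset.add_sum_erase _ (fun w => φ w (st w)) (Finset.mem_univ u), Function.update_self]
  have : ∑ w ∈ Finset.univ.erase u, φ w (Function.update st u y w)
      = ∑ w ∈ Finset.univ.erase u, φ w (st w) :=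
    Finset.sum_congr rfl fun w hw => by rw [Function.update_of_ne (Finset.ne_of_mem_erase hw)]
  omega

variable {G x}

theorem Invariant.lit_eq {r : Option (Fin n) → ℕ} {s : SearchState n} (h : Invariant G x r s)
    {v : Option (Fin n)} {d : EdgeData n} (hd : d.Correct G x v) {b : Bool}
    (hb : d.lit s.status = some b) : b = G.literal x v d.target := by
  unfold EdgeData.lit at hb
  unfold CircuitDag.literal
  rw [← hd.sgn_eq]
  split_ifs at hb with h0
  · rw [← hd.leaf_eq h0]
    exact (Option.some.inj hb).symm
  · split at hb
    · rename_i b' hb'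
      rw [h.done_eq _ _ hb'] at hb
      exact (Option.some.inj hb).symm
    · exact absurd hb (by simp)

/-- Processing an argument moves the position forward or closes the vertex, so fewer steps remain. A
false literal is paid for: it closes an AND, and at any other gate it uses up one of the remaining
positions. -/
theorem Invariant.advance {r : Option (Fin n) → ℕ} {s : SearchState n}
    (h : Invariant G x r s) {v : Option (Fin n)} {rest : List (Option (Fin n))}
    (hs : s.stack = v :: rest) {op : Gate} {deg p : ℕ} {a : Bool}
    (hv : s.status v = .active op deg p a) {b : Bool} {j : Fin n}
    (hj : (G.args v)[p]? = some j) (hb : b = G.literal x v j) :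
    Invariant G x r (advance s v rest b) ∧
      ∑ w, steps G w ((CircuitSearch.advance s v rest b).status w) < ∑ w, steps G w (s.status w) ∧
      ∑ w, faults G w ((CircuitSearch.advance s v rest b).status w) + (if b = true then 0 else 1)
        ≤ ∑ w, faults G w (s.status w) := by
  obtain ⟨hop, hdeg, hp, ha, hand⟩ := h.active_eq _ _ _ _ _ hv
  have hne : G.args v ≠ [] := by
    intro hc; rw [hc] at hj; simp at hj
  have htake : (G.args v).take (p + 1) = (G.args v).take p ++ [j] := by
    rw [List.take_add_one, hj]; rfl
  have hacc : op.eval [a, b]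
      = (G.gate v).eval (((G.args v).take (p + 1)).map (G.literal x v)) := by
    rw [htake, List.map_append, List.map_singleton, Gate.eval_append_singleton, ← ha, hop, hb]
  have hsort := h.sorted
  rw [hs, List.pairwise_cons] at hsort
  have hvrest : v ∉ rest := fun hc => (hsort.1 v hc).false
  have hmem : ∀ w, w ≠ v → (w ∈ rest ↔ ∃ op d p a, s.status w = .active op d p a) := by
    intro w hw
    rw [← h.mem_stack w, hs]
    simp [hw]
  have h1 := sum_update_add (steps G) s.status v
  have h2 := sum_update_add (faults G) s.status v
  rw [hv] at h1 h2
  unfold CircuitSearch.advance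
  rw [hv]
  simp only
  by_cases hfin : p + 1 = deg ∨ (op = .and ∧ b = false)
  · simp only [if_pos hfin]
    have hval : op.eval [a, b] = G.extValue x v := by
      rw [G.extValue_eq x hne]
      rcases hfin with hfin | ⟨hand', hb'⟩
      · rw [hacc, hfin, hdeg, List.take_length]
      -- One false argument decides an AND, whatever the unread arguments are.
      · have hjm : j ∈ G.args v := List.mem_of_getElem? hj
        rw [← hop, hand']
        simp only [Gate.eval, hb', List.all_cons, List.all_nil, id, Bool.and_true, Bool.and_false]
        symm
        rw [List.all_eq_false]
        exact ⟨G.literal x v j, List.mem_map_of_mem hjm, by simp [← hb, hb']⟩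
    refine ⟨⟨?_, ?_, ?_, hsort.2, ?_⟩, ?_, ?_⟩
    · intro w b' hw
      by_cases hwv : w = v
      · subst hwv
        simp only [Function.update_self, Status.done.injEq] at hw
        rw [← hw, hval]
      · simp only [Function.update_of_ne hwv] at hw
        exact h.done_eq _ _ hw
    · intro w
      by_cases hwv : w = v
      · subst hwv
        simp [hvrest]
      · simp only [Function.update_of_ne hwv]
        exact hmem w hwv
    · intro w op' d' p' a' hw
      by_cases hwv : w = v
      · subst hwv
        simp at hw
      · simp only [Function.update_of_ne hwv] at hw
        exact h.active_eq _ _ _ _ _ hw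
    · by_cases hwv : none = v
      · subst hwv; simp
      · simp only [Function.update_of_ne hwv, ne_eq]
        exact h.none_ne
    · have := h1 (.done (op.eval [a, b]))
      simp only [steps] at this ⊢
      omega
    · have := h2 (.done (op.eval [a, b]))
      simp only [faults] at this ⊢
      split_ifs at this ⊢ <;> omega
  · simp only [if_neg hfin]
    push Not at hfin
    have hp1 : p + 1 < deg := by omega
    refine ⟨⟨?_, ?_, ?_, List.pairwise_cons.2 hsort, ?_⟩, ?_, ?_⟩
    · intro w b' hw
      by_cases hwv : w = v
      · subst hwv
        simp at hw
      · simp only [Function.update_of_ne hwv] at hw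
        exact h.done_eq _ _ hw
    · intro w
      by_cases hwv : w = v
      · subst hwv
        simp
      · simp only [Function.update_of_ne hwv, List.mem_cons, hwv, false_or]
        exact hmem w hwv
    · intro w op' d' p' a' hw
      by_cases hwv : w = v
      · subst hwv
        simp only [Function.update_self, Status.active.injEq] at hw
        obtain ⟨rfl, rfl, rfl, rfl⟩ := hw
        refine ⟨hop, hdeg, hp1, hacc, fun hg => ?_⟩
        have hb' : b = true := by simpa using hfin.2 (hop.trans hg)
        rw [hop, hg, hand hg, hb']
        rfl
      · simp only [Function.update_of_ne hwv] at hw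
        exact h.active_eq _ _ _ _ _ hw
    · by_cases hwv : none = v
      · subst hwv; simp
      · simp only [Function.update_of_ne hwv, ne_eq]
        exact h.none_ne
    · have := h1 (.active op deg (p + 1) (op.eval [a, b]))
      simp only [steps] at this ⊢
      omega
    · have := h2 (.active op deg (p + 1) (op.eval [a, b]))
      simp only [faults] at this ⊢
      by_cases hg : op = .and
      · have hb' : b = true := by simpa using hfin.2 hg
        simp only [hg, hb', if_true] at this ⊢
        omega
      · simp only [if_neg hg] at this ⊢
        split_ifs <;> omega

/-- The stack is sorted by rank, so the target lies strictly below every vertex under evaluation and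
is not on the stack. An unknown literal therefore means a fresh target, and its initial allowance
pays for the step and for the fault. -/
theorem Invariant.descend (hG : G.IsXorAnd) {r : Option (Fin n) → ℕ}
    (hr : ∀ v, ∀ j ∈ G.args v, r (some j) < r v) {s : SearchState n}
    (h : Invariant G x r s) {v : Option (Fin n)} {rest : List (Option (Fin n))}
    (hs : s.stack = v :: rest) {d : EdgeData n} (hd : d.Correct G x v)
    (hj : d.target ∈ G.args v) (hlit : d.lit s.status = none) :
    Invariant G x r (descend s d) ∧
      ∑ w, steps G w ((CircuitSearch.descend s d).status w) < ∑ w, steps G w (s.status w) ∧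
      ∑ w, faults G w ((CircuitSearch.descend s d).status w) + 1
        ≤ ∑ w, faults G w (s.status w) := by
  have hsort := h.sorted
  rw [hs, List.pairwise_cons] at hsort
  have hlt : ∀ w ∈ s.stack, r (some d.target) < r w := by
    intro w hw
    rw [hs, List.mem_cons] at hw
    rcases hw with rfl | hw
    · exact hr _ _ hj
    · exact (hr _ _ hj).trans (hsort.1 w hw)
  have hnot : some d.target ∉ s.stack := fun hc => (hlt _ hc).false
  have hd0 : d.deg ≠ 0 := by
    intro hc; simp [EdgeData.lit, hc] at hlit
  have hfresh : s.status (some d.target) = .fresh := by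
    simp only [EdgeData.lit, if_neg hd0] at hlit
    cases hst : s.status (some d.target) with
    | fresh => rfl
    | active op d p a => exact absurd ((h.mem_stack _).2 ⟨_, _, _, _, hst⟩) hnot
    | done b => rw [hst] at hlit; simp at hlit
  have hne : G.out d.target ≠ [] := by
    intro hc; apply hd0; rw [hd.deg_eq, hc]; rfl
  have h1 := sum_update_add (steps G) s.status (some d.target)
    (.active d.op d.deg 0 (d.op.eval []))
  have h2 := sum_update_add (faults G) s.status (some d.target)
    (.active d.op d.deg 0 (d.op.eval []))
  rw [hfresh] at h1 h2
  refine ⟨⟨?_, ?_, ?_, ?_, ?_⟩, ?_, ?_⟩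
  · intro w b' hw
    by_cases hwv : w = some d.target
    · subst hwv
      simp [CircuitSearch.descend] at hw
    · simp only [CircuitSearch.descend, Function.update_of_ne hwv] at hw
      exact h.done_eq _ _ hw
  · intro w
    by_cases hwv : w = some d.target
    · subst hwv
      simp [CircuitSearch.descend]
    · simp only [CircuitSearch.descend, Function.update_of_ne hwv, List.mem_cons, hwv, false_or]
      exact h.mem_stack w
  · intro w op' d' p' a' hw
    by_cases hwv : w = some d.target
    · subst hwv
      simp only [CircuitSearch.descend, Function.update_self, Status.active.injEq] at hw
      obtain ⟨rfl, rfl, rfl, rfl⟩ := hw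
      refine ⟨hd.op_eq, hd.deg_eq, Nat.pos_of_ne_zero hd0, ?_, fun hg => ?_⟩
      · rw [hd.op_eq]; simp [CircuitDag.gate]
      · rw [hd.op_eq, show G.op d.target = .and from hg]; rfl
    · simp only [CircuitSearch.descend, Function.update_of_ne hwv] at hw
      exact h.active_eq _ _ _ _ _ hw
  · exact List.pairwise_cons.2 ⟨hlt, h.sorted⟩
  · simp only [CircuitSearch.descend]
    rw [Function.update_of_ne (by simp)]
    exact h.none_ne
  · have e1 : steps G (some d.target) .fresh = (G.out d.target).length + 1 := by
      simp [steps, CircuitDag.args, hne]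
    have e2 : steps G (some d.target) (.active d.op d.deg 0 (d.op.eval [])) = d.deg := rfl
    have := hd.deg_eq
    simp only [CircuitSearch.descend]
    omega
  · have e1 : faults G (some d.target) .fresh = 3 := by
      simp [faults, CircuitDag.args, hne]
    -- An open AND can still cause one fault, an open XOR two because it is binary. The third unit
    -- of a fresh vertex pays for opening it.
    have e2 : faults G (some d.target) (.active d.op d.deg 0 (d.op.eval [])) ≤ 2 := by
      simp only [faults]
      have h3 := hd.deg_eq
      have h4 := hd.op_eq
      rcases hG _ hne with h5 | h5
      · rw [h4, h5, if_pos rfl]; omega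
      · split_ifs <;> omega
    simp only [CircuitSearch.descend]
    omega

theorem Invariant.step (hG : G.IsXorAnd) {r : Option (Fin n) → ℕ}
    (hr : ∀ v, ∀ j ∈ G.args v, r (some j) < r v) {s : SearchState n}
    (h : Invariant G x r s) {v : Option (Fin n)} {rest : List (Option (Fin n))}
    (hs : s.stack = v :: rest) {d : EdgeData n} (hd : d.Correct G x v)
    (hj : (G.args v)[(s.status v).pos]? = some d.target) :
    Invariant G x r (step s v rest d) ∧
      ∑ w, steps G w ((CircuitSearch.step s v rest d).status w) < ∑ w, steps G w (s.status w) ∧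
      ∑ w, faults G w ((CircuitSearch.step s v rest d).status w)
        + (if d.lit s.status = some true then 0 else 1) ≤ ∑ w, faults G w (s.status w) := by
  obtain ⟨op, deg, p, a, hv⟩ := (h.mem_stack v).1 (by rw [hs]; exact List.mem_cons_self)
  rw [hv] at hj
  unfold CircuitSearch.step
  cases hlit : d.lit s.status with
  | none =>
    have := h.descend hG hr hs hd (List.mem_of_getElem? hj) hlit
    simpa using this
  | some b =>
    have := h.advance hs hv hj (h.lit_eq hd hlit)
    simpa using this

end Correctness

end CircuitSearch

instance (n N : ℕ) : Inhabited (Query n N) := ⟨.root⟩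

namespace CircuitSearch

variable {n N : ℕ}

/-! ### The search as a machine with predictions -/

section Machine

variable [NeZero n] [NeZero N]

/-- The vertex coded by an answer of the oracle. -/
def vertexOf (a : Answer n N) : Fin n := Fin.ofNat n a.val

/-- The label coded by an answer of the oracle. -/
def gateOf (a : Answer n N) : Gate := if a = 0 then .and else if a = 1 then .or else .xor

/-- The data of an edge that starts at `v`, coded by six answers of the oracle. -/
def edgeDataOf (v : Option (Fin n)) (a : Fin 6 → Answer n N) : EdgeData n where
  target := vertexOf (a 0)
  deg := (a 1).val
  op := gateOf (a 3)
  sgn := v.elim true fun _ => decide (a 2 = 1)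
  leaf := decide (a 5 = 1)

/-- The six queries that read the edge at position `pos` of the vertex `v`. -/
def edgeQuery (v : Option (Fin n)) (pos : ℕ) (i : ℕ) (a : Fin 6 → Answer n N) : Query n N :=
  match i with
  | 0 => v.elim .root fun u => .neighbor u (Fin.ofNat n pos)
  | 1 => .degree (vertexOf (a 0))
  | 2 => v.elim .root fun u => .sign u (vertexOf (a 0))
  | 3 => .op (vertexOf (a 0))
  | 4 => .var (vertexOf (a 0))
  | 5 => .input (Fin.ofNat N (a 4).val)
  | _ => .root

theorem isAdaptive_edgeQuery (v : Option (Fin n)) (pos : ℕ) :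
    IsAdaptive (edgeQuery (N := N) v pos) := by
  intro i a a' h
  match i with
  | 0 => rfl
  | 1 => simp only [edgeQuery]; rw [h 0 (by decide)]
  | 2 => simp only [edgeQuery]; rw [h 0 (by decide)]
  | 3 => simp only [edgeQuery]; rw [h 0 (by decide)]
  | 4 => simp only [edgeQuery]; rw [h 0 (by decide)]
  | 5 => simp only [edgeQuery]; rw [h 4 (by decide)]
  | i + 6 => rfl

/-- Evaluation of a circuit by depth-first search. It is predicted that the next literal is known
and true. -/
def machine (n N : ℕ) [NeZero n] [NeZero N] :
    GuessingMachine (Query n N) (Answer n N) 6 where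
  State := SearchState n
  start := ⟨fun v => v.elim (.active .and 1 0 true) fun _ => .fresh, [none]⟩
  query s := match s.stack with
    | [] => fun _ _ => .root
    | v :: _ => edgeQuery v (s.status v).pos
  branch s a := match s.stack with
    | [] => none
    | v :: _ => if (edgeDataOf v a).lit s.status = some true then none else some a
  next s b := match s.stack with
    | [] => s
    | v :: rest => b.elim (advance s v rest true) fun a => step s v rest (edgeDataOf v a)
  out s := match s.status none with
    | .done b => b
    | _ => false

theorem vertexOf_natCast (i : Fin n) : vertexOf (N := N) ((i : ℕ) : Answer n N) = i := by
  unfold vertexOf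
  rw [ZMod.val_natCast_of_lt (by omega)]
  exact Fin.ofNat_val_eq_self i

variable (G : CircuitDag n N) (x : Fin N → Bool)

theorem length_args_le (v : Option (Fin n)) : (G.args v).length ≤ n := by
  rcases v with _ | i
  · exact Nat.one_le_iff_ne_zero.2 (NeZero.ne n)
  · have : (G.out i).length ≤ n := by simpa using (G.nodup i).length_le_card
    exact this

/-- The alphabet is large enough to decode every answer without collision. At a non-sink the
variable and input answers carry no meaning, but `leaf` is claimed to be correct only at degree
zero. -/
theorem oracle_edgeQuery {v : Option (Fin n)} {pos : ℕ} {a : Fin 6 → Answer n N}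
    (ha : ∀ j : Fin 6, a j = G.oracle x (edgeQuery v pos j a)) (hpos : pos < (G.args v).length) :
    (G.args v)[pos]? = some (edgeDataOf v a).target ∧ (edgeDataOf v a).Correct G x v := by
  have hn : 0 < n := Nat.pos_of_ne_zero (NeZero.ne n)
  have hposn := hpos.trans_le (length_args_le G v)
  obtain ⟨j, hj⟩ : ∃ j, (G.args v)[pos]? = some j := ⟨_, List.getElem?_eq_getElem hpos⟩
  have h0 : vertexOf (a 0) = j := by
    have h := ha 0
    rcases v with _ | u
    · simp only [CircuitDag.args, List.length_singleton, Nat.lt_one_iff] at hpos hj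
      subst hpos
      simp only [List.getElem?_cons_zero, Option.some.injEq] at hj
      rw [h, ← hj]
      exact vertexOf_natCast _
    · have hk : ((Fin.ofNat n pos : Fin n) : ℕ) = pos := by simp [Nat.mod_eq_of_lt hposn]
      have h' : a 0 = (((G.out u)[((Fin.ofNat n pos : Fin n) : ℕ)]?.elim 0 fun j => (j : ℕ) : ℕ) :
        Answer n N) := h
      rw [hk, show (G.out u)[pos]? = some j from hj] at h'
      rw [h']
      exact vertexOf_natCast _
  have h1 : a 1 = ((G.out j).length : Answer n N) := by rw [← h0]; exact ha 1
  have h3 := ha 3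
  have h4 : a 4 = ((G.var j : ℕ) : Answer n N) := by rw [← h0]; exact ha 4
  have h5 : a 5 = if x (G.var j) then 1 else 0 := by
    have h := ha 5
    have hv : Fin.ofNat N (a 4).val = G.var j := by
      rw [h4, ZMod.val_natCast_of_lt (by omega)]
      exact Fin.ofNat_val_eq_self _
    have h' : a 5 = if x (Fin.ofNat N (a 4).val) then 1 else 0 := h
    rw [h', hv]
  have h10 : (1 : Answer n N) ≠ 0 := by
    have : Fact (1 < n + N + 2) := ⟨by omega⟩
    exact one_ne_zero
  have h20 : (2 : Answer n N) ≠ 0 := by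
    intro hc
    have := congrArg ZMod.val hc
    have h2 : ((2 : ℕ) : Answer n N).val = 2 := ZMod.val_natCast_of_lt (by omega)
    rw [Nat.cast_ofNat] at h2
    rw [h2, ZMod.val_zero] at this
    exact absurd this (by decide)
  have h21 : (2 : Answer n N) ≠ 1 := by
    intro hc
    apply h10
    have h2 : (1 : Answer n N) + 1 = 1 := by rw [one_add_one_eq_two]; exact hc
    simpa using h2
  have hdeg : (edgeDataOf v a).deg = (G.out j).length := by
    simp only [edgeDataOf]
    rw [h1]
    have := length_args_le G (some j)
    exact ZMod.val_natCast_of_lt (Nat.lt_of_le_of_lt this (by omega))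
  refine ⟨by rw [hj]; exact congrArg some h0.symm, ?_, ?_, ?_, ?_⟩
  · rw [hdeg]
    simp only [edgeDataOf]
    rw [h0]
  · simp only [edgeDataOf]
    rw [h3]
    change gateOf (match G.op (vertexOf (a 0)) with
      | .and => (0 : Answer n N)
      | .or => 1
      | .xor => 2) = _
    cases G.op (vertexOf (a 0)) <;> simp [gateOf, h10, h20, h21]
  · rcases v with _ | u
    · rfl
    · have h2 : a 2 = if G.sign u (vertexOf (a 0)) then 1 else 0 := ha 2
      simp only [edgeDataOf, Option.elim, CircuitDag.edgeSign]
      rw [h2]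
      cases G.sign u (vertexOf (a 0)) <;> simp [h10.symm]
  · intro hd
    rw [hdeg, List.length_eq_zero_iff] at hd
    simp only [edgeDataOf]
    rw [h0, G.value_eq, if_pos hd, h5]
    cases x (G.var j) <;> simp [h10.symm]

theorem exists_rank_args (G : CircuitDag n N) :
    ∃ r : Option (Fin n) → ℕ, ∀ v, ∀ j ∈ G.args v, r (some j) < r v := by
  obtain ⟨r, hr⟩ := G.exists_rank
  refine ⟨fun v => v.elim (r G.root + 1) r, ?_⟩
  rintro (_ | i) j hj
  · rw [List.mem_singleton.1 hj]
    exact Nat.lt_succ_self _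
  · exact hr i j hj

variable {G} in
theorem invariant_start (r : Option (Fin n) → ℕ) : Invariant G x r (machine n N).start := by
  refine ⟨?_, ?_, ?_, List.pairwise_singleton _ _, ?_⟩
  · rintro (_ | i) b h <;> simp [machine] at h
  · rintro (_ | i) <;> simp [machine]
  · rintro (_ | i) op d p a h
    · simp only [machine, Option.elim, Status.active.injEq] at h
      obtain ⟨rfl, rfl, rfl, rfl⟩ := h
      exact ⟨rfl, rfl, Nat.one_pos, rfl, fun _ => rfl⟩
    · simp [machine] at h
  · simp [machine]

theorem sum_steps_start :
    ∑ w, steps G w ((machine n N).start.status w) = 1 + (G.numEdges + G.numNonSinks) := by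
  rw [Fintype.sum_option, CircuitDag.numEdges, CircuitDag.numNonSinks, Finset.card_filter,
    ← Finset.sum_add_distrib]
  congr 1
  refine Finset.sum_congr rfl fun i _ => ?_
  change (if G.out i = [] then 0 else (G.out i).length + 1) = _
  by_cases h : G.out i = [] <;> simp [h]

theorem sum_faults_start :
    ∑ w, faults G w ((machine n N).start.status w) = 1 + 3 * G.numNonSinks := by
  rw [Fintype.sum_option, CircuitDag.numNonSinks, Finset.card_filter, Finset.mul_sum]
  congr 1
  refine Finset.sum_congr rfl fun i _ => ?_
  change (if G.out i = [] then 0 else 3) = _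
  by_cases h : G.out i = [] <;> simp [h]

variable {G} in
-- The two potentials pay for steps and mistakes. With an empty stack the state stands still and the
-- predicted branch is reported, so running on does no harm.
theorem run_spec (hG : G.IsXorAnd) {r : Option (Fin n) → ℕ}
    (hr : ∀ v, ∀ j ∈ G.args v, r (some j) < r v) (t : ℕ) :
    Invariant G x r ((machine n N).run (G.oracle x) t) ∧
    (((machine n N).run (G.oracle x) t).stack = [] ∨
      ∑ w, steps G w (((machine n N).run (G.oracle x) t).status w) + t
        ≤ 1 + (G.numEdges + G.numNonSinks)) ∧
    (machine n N).mistakes (G.oracle x) t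
      + ∑ w, faults G w (((machine n N).run (G.oracle x) t).status w)
      ≤ 1 + 3 * G.numNonSinks := by
  induction t with
  | zero =>
    exact ⟨invariant_start x r, Or.inr (sum_steps_start G).le,
      by rw [show (machine n N).mistakes (G.oracle x) 0 = 0 from rfl, zero_add]
         exact (sum_faults_start G).le⟩
  | succ t ih =>
    obtain ⟨h1, h2, h3⟩ := ih
    have hmis : (machine n N).mistakes (G.oracle x) (t + 1)
        = (machine n N).mistakes (G.oracle x) t
          + if (machine n N).branchAt (G.oracle x) ((machine n N).run (G.oracle x) t) ≠ none
            then 1 else 0 := by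
      simp only [GuessingMachine.mistakes, Finset.card_filter, Finset.sum_range_succ]
    have hrun : (machine n N).run (G.oracle x) (t + 1)
        = (machine n N).next ((machine n N).run (G.oracle x) t)
          ((machine n N).branchAt (G.oracle x) ((machine n N).run (G.oracle x) t)) := rfl
    rw [hmis, hrun]
    clear hmis hrun
    generalize (machine n N).run (G.oracle x) t = s at h1 h2 h3
    have hadapt : IsAdaptive ((machine n N).query s) := by
      simp only [machine]
      split
      · intro i a a' _; rfl
      · exact isAdaptive_edgeQuery _ _
    set a := trace (G.oracle x) ((machine n N).query s) 6 with ha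
    have hbr : (machine n N).branchAt (G.oracle x) s = (machine n N).branch s a := rfl
    have htr := trace_eq (f := G.oracle x) hadapt
    rw [← ha] at htr
    rw [hbr]
    cases hs : s.stack with
    | nil =>
      have hb : (machine n N).branch s a = none := by simp only [machine, hs]
      have hn : (machine n N).next s none = s := by simp only [machine, hs]; rfl
      rw [hb, hn]
      exact ⟨h1, Or.inl hs, by simpa using h3⟩
    | cons v rest =>
      have hq : (machine n N).query s = edgeQuery v (s.status v).pos := by
        simp only [machine, hs]
      have hb : (machine n N).branch s a
          = if (edgeDataOf v a).lit s.status = some true then none else some a := by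
        simp only [machine, hs]
      have hn : ∀ b, (machine n N).next s b
          = b.elim (advance s v rest true) fun a => step s v rest (edgeDataOf v a) := by
        intro b; simp only [machine, hs]
      -- On the predicted branch the transition does not see the answers. Nothing is lost: a known
      -- true literal has the same effect whichever edge it comes from.
      have hnext : (machine n N).next s ((machine n N).branch s a)
          = step s v rest (edgeDataOf v a) := by
        rw [hb, hn]
        split_ifs with hl
        · simp only [Option.elim, step, hl]
          rfl
        · rfl
      obtain ⟨op, d, p, acc, hv⟩ := (h1.mem_stack v).1 (by rw [hs]; exact List.mem_cons_self)
      obtain ⟨-, hd, hp, -, -⟩ := h1.active_eq _ _ _ _ _ hv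
      have hpos : (s.status v).pos < (G.args v).length := by
        rw [hv, ← hd]; exact hp
      rw [hq] at htr
      obtain ⟨hj, hc⟩ := oracle_edgeQuery G x htr hpos
      obtain ⟨k1, k2, k3⟩ := h1.step hG hr hs hc hj
      rw [hnext]
      refine ⟨k1, Or.inr ?_, ?_⟩
      · rcases h2 with h2 | h2
        · rw [hs] at h2; exact absurd h2 (by simp)
        · omega
      · rw [hb]
        by_cases hl : (edgeDataOf v a).lit s.status = some true
        · rw [if_pos hl] at k3 ⊢
          simp only [ne_eq, not_true_eq_false, if_false]
          omega
        · rw [if_neg hl] at k3 ⊢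
          simp only [ne_eq, reduceCtorEq, not_false_eq_true, if_true]
          omega

variable {G} in
/-- The search evaluates the circuit, with few wrong predictions. -/
theorem machine_spec (hG : G.IsXorAnd) {T : ℕ} (hT : 1 + (G.numEdges + G.numNonSinks) < T) :
    (machine n N).out ((machine n N).run (G.oracle x) T) = G.eval x ∧
      (machine n N).mistakes (G.oracle x) T ≤ 1 + 3 * G.numNonSinks := by
  obtain ⟨r, hr⟩ := exists_rank_args G
  obtain ⟨h1, h2, h3⟩ := run_spec x hG hr T
  refine ⟨?_, by omega⟩
  have hs : ((machine n N).run (G.oracle x) T).stack = [] := by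
    rcases h2 with h2 | h2
    · exact h2
    · omega
  generalize (machine n N).run (G.oracle x) T = s at h1 hs
  cases hst : s.status none with
  | fresh => exact absurd hst h1.none_ne
  | active op d p a =>
    have := (h1.mem_stack none).2 ⟨_, _, _, _, hst⟩
    rw [hs] at this
    exact absurd this (by simp)
  | done b =>
    simp only [machine, hst]
    exact h1.done_eq _ _ hst

end Machine

/-! ### The query bound for circuits -/

/-- An algorithm without queries. -/
noncomputable def trivialAlgorithm (n N : ℕ) : QueryAlgorithm (Query n N) (Answer n N) where
  Work := Unit
  queries := 0
  U _ := 1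
  init := default
  output _ := true

theorem prob_trivialAlgorithm_le (n N : ℕ) (f : Query n N → Answer n N) (b : Bool) :
    (trivialAlgorithm n N).prob f b ≤ 1 := by
  unfold QueryAlgorithm.prob
  have h : ∀ s, (if (trivialAlgorithm n N).output s = b then
      ‖(trivialAlgorithm n N).state f (trivialAlgorithm n N).queries s‖ ^ 2 else 0)
      ≤ if s = (trivialAlgorithm n N).init then (1 : ℝ) else 0 := by
    intro s
    have hs : (trivialAlgorithm n N).state f (trivialAlgorithm n N).queries s
        = if s = (trivialAlgorithm n N).init then 1 else 0 := by
      change ((1 : Matrix (Query n N × Answer n N × (trivialAlgorithm n N).Work) _ ℂ)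
        *ᵥ Pi.single (trivialAlgorithm n N).init 1) s = _
      rw [Matrix.one_mulVec, Pi.single_apply]
    rw [hs]
    split_ifs <;> simp
  refine (Finset.sum_le_sum fun s _ => h s).trans ?_
  simp

/-- Quantum query algorithms evaluate circuits fast. -/
theorem exists_algorithm (n N nhat m : ℕ) (h1 : 1 ≤ nhat) (hn : nhat ≤ n) :
    ∃ 𝒜 : QueryAlgorithm (Query n N) (Answer n N),
      (𝒜.queries : ℝ) ≤ 40000 * (√(nhat * m) * Real.log nhat) ∧
      ∀ G : CircuitDag n N, G.IsXorAnd → G.numNonSinks = nhat → G.numEdges = m →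
        ∀ x : Fin N → Bool, 𝒜.prob (G.oracle x) (!(G.eval x)) ≤ 1 / nhat := by
  have hlog : 0 ≤ Real.log nhat := Real.log_natCast_nonneg nhat
  -- For `nhat = 1` the logarithm allows no query, but the error bound is 1. In the other two cases
  -- no circuit qualifies: non-sinks have at least two edges, and the label of the root needs a
  -- variable.
  by_cases hvac : nhat = 1 ∨ m < 2 * nhat ∨ N = 0
  · refine ⟨trivialAlgorithm n N, ?_, fun G _ hGn hGm x => ?_⟩
    · simp only [trivialAlgorithm, Nat.cast_zero]
      positivity
    · rcases hvac with rfl | hm | rfl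
      · simpa using prob_trivialAlgorithm_le n N (G.oracle x) (!(G.eval x))
      · have := G.numNonSinks_mul_two_le
        omega
      · exact (G.var G.root).elim0
  · push Not at hvac
    obtain ⟨hnhat, hm, hN⟩ := hvac
    have : NeZero n := ⟨by omega⟩
    have : NeZero N := ⟨hN⟩
    -- Here `m ≥ 2 nhat ≥ 4`, so `6m` exceeds the step bound and `6 nhat` the mistake bound; with `k
    -- = ⌈log₂ nhat⌉` copies the error is `2⁻ᵏ ≤ 1/nhat`.
    obtain ⟨𝒜, hq, h𝒜⟩ := (machine n N).exists_queryAlgorithm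
      (fun s => by
        simp only [machine]
        split
        · intro i a a' _; rfl
        · exact isAdaptive_edgeQuery _ _)
      (T := 6 * m) (R := 6 * nhat) (by omega) (by omega) (Nat.clog 2 nhat)
    refine ⟨𝒜, ?_, fun G hG hGn hGm x => ?_⟩
    · have h2 : (2 : ℝ) ≤ nhat := by exact_mod_cast (by omega : 2 ≤ nhat)
      have hm' : (2 * nhat : ℝ) ≤ m := by exact_mod_cast hm
      set s := √((nhat : ℝ) * m) with hs
      have hs1 : 1 ≤ s := Real.one_le_sqrt.2 (by nlinarith)
      have hs6 : √(((6 * nhat : ℕ) : ℝ) * ((6 * m : ℕ) : ℝ)) = 6 * s := by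
        push_cast
        rw [show (6 * (nhat : ℝ)) * (6 * m) = 6 ^ 2 * (nhat * m) by ring,
          Real.sqrt_mul (by norm_num), Real.sqrt_sq (by norm_num)]
      have hc : ((⌈85 * √(((6 * nhat : ℕ) : ℝ) * ((6 * m : ℕ) : ℝ))⌉₊ : ℕ) : ℝ) ≤ 511 * s := by
        rw [hs6]
        have := (Nat.ceil_lt_add_one (a := 85 * (6 * s)) (by positivity)).le
        linarith
      -- For `nhat ≥ 2`: `⌈log₂ nhat⌉ ≤ log nhat / log 2 + 1 ≤ 2 log nhat / log 2 ≤ 3 log nhat`.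
      have hk : ((Nat.clog 2 nhat : ℕ) : ℝ) ≤ 3 * Real.log nhat := by
        have hl2 : 0.6931471803 < Real.log 2 := Real.log_two_gt_d9
        have hle : Real.log 2 ≤ Real.log nhat := Real.log_le_log (by norm_num) h2
        have hpow : 2 ^ (Nat.clog 2 nhat).pred < nhat :=
          Nat.pow_pred_clog_lt_self (by norm_num) (by omega)
        have hpos : 0 < Nat.clog 2 nhat := Nat.clog_pos (by norm_num) (by omega)
        have hpow' : ((Nat.clog 2 nhat).pred : ℝ) * Real.log 2 ≤ Real.log nhat := by
          rw [← Real.log_pow]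
          exact Real.log_le_log (by positivity) (by exact_mod_cast hpow.le)
        have hpred : ((Nat.clog 2 nhat : ℕ) : ℝ) = ((Nat.clog 2 nhat).pred : ℝ) + 1 := by
          exact_mod_cast (Nat.succ_pred_eq_of_pos hpos).symm
        rw [hpred]
        nlinarith
      rw [hq]
      push_cast at hc ⊢
      have hk0 : (0 : ℝ) ≤ (Nat.clog 2 nhat : ℕ) := Nat.cast_nonneg _
      -- `24 = 4 · 6` comes from six queries per step, and `24 · 511 · 3 = 36792 ≤ 40000`.
      calc _ ≤ 24 * (511 * s) * (3 * Real.log nhat) := by gcongr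
        _ ≤ _ := by nlinarith [mul_nonneg (zero_le_one.trans hs1) hlog]
    · have hT : 1 + (G.numEdges + G.numNonSinks) < 6 * m := by omega
      obtain ⟨hout, hmis⟩ := machine_spec x hG hT
      rw [← hout]
      refine (h𝒜 _ (by omega)).trans ?_
      rw [one_div_pow]
      apply one_div_le_one_div_of_le
      · exact_mod_cast h1
      · exact_mod_cast Nat.le_pow_clog (by norm_num) nhat

end CircuitSearch

/-! ### Replacing XOR by AND, OR and negation -/

namespace CircuitDag

variable {n N : ℕ} (G : CircuitDag n N)

/-- The vertices that compute an XOR. -/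
abbrev XorVertex : Type := {i : Fin n // G.out i ≠ [] ∧ G.op i = .xor}

/-- The vertices of the circuit in which every XOR `a ⊕ b` becomes `(a ∧ ¬b) ∨ (¬a ∧ b)`. -/
abbrev SplitVertex : Type := Fin n ⊕ (G.XorVertex × Bool)

/-- The adjacency lists after the XORs are replaced. -/
def splitOut : G.SplitVertex → List G.SplitVertex
  | .inl i => if h : G.out i ≠ [] ∧ G.op i = .xor then
      [.inr (⟨i, h⟩, false), .inr (⟨i, h⟩, true)] else (G.out i).map .inl
  | .inr (i, _) => (G.out i).map .inl

/-- The gates after the XORs are replaced. -/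
def splitOp : G.SplitVertex → Gate
  | .inl i => if G.op i = .xor then .or else G.op i
  | .inr _ => .and

/-- The signs of the edges after the XORs are replaced. -/
def splitSign : G.SplitVertex → G.SplitVertex → Bool
  | .inl i, .inl j => G.sign i j
  | .inr (i, b), .inl j => G.sign i j == (decide ((G.out i).head? = some j) ^^ b)
  | _, .inr _ => true

/-- The variables after the XORs are replaced. -/
def splitVar : G.SplitVertex → Fin N
  | .inl i => G.var i
  | .inr (i, _) => G.var i

/-- Doubling the ranks makes room for the new ANDs: they get `2r`, just below their OR at `2r + 1`
and above its former arguments, which have rank at most `2r − 1`. -/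
theorem exists_splitRank : ∃ r : G.SplitVertex → ℕ, ∀ v, ∀ w ∈ G.splitOut v, r w < r v := by
  obtain ⟨r, hr⟩ := G.exists_rank
  refine ⟨Sum.elim (fun i => 2 * r i + 1) fun p => 2 * r p.1, ?_⟩
  rintro (i | ⟨i, b⟩) w hw
  · simp only [splitOut] at hw
    split_ifs at hw with h
    · simp only [List.mem_cons, List.not_mem_nil, or_false] at hw
      rcases hw with rfl | rfl <;> simp
    · obtain ⟨j, hj, rfl⟩ := List.mem_map.1 hw
      have := hr i j hj
      simp only [Sum.elim_inl]
      omega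
  · simp only [splitOut] at hw
    obtain ⟨j, hj, rfl⟩ := List.mem_map.1 hw
    have := hr i j hj
    simp only [Sum.elim_inl, Sum.elim_inr]
    omega

/-- The circuit in which every XOR is replaced by an OR of two ANDs. -/
noncomputable def splitXor : CircuitDag (Fintype.card G.SplitVertex) N where
  out k := (G.splitOut ((Fintype.equivFin _).symm k)).map (Fintype.equivFin _)
  nodup k := by
    apply List.Nodup.map (Fintype.equivFin _).injective
    rcases (Fintype.equivFin G.SplitVertex).symm k with i | ⟨i, b⟩
    · simp only [splitOut]
      split_ifs with h
      · simp
      · exact (G.nodup i).map Sum.inl_injective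
    · exact (G.nodup i).map Sum.inl_injective
  acyclic k hk := by
    obtain ⟨r, hr⟩ := G.exists_splitRank
    have key : ∀ a b, Relation.TransGen (fun a b => b ∈ (G.splitOut
        ((Fintype.equivFin _).symm a)).map (Fintype.equivFin _)) a b →
        r ((Fintype.equivFin _).symm b) < r ((Fintype.equivFin _).symm a) := by
      have one : ∀ a b, b ∈ (G.splitOut ((Fintype.equivFin _).symm a)).map (Fintype.equivFin _) →
          r ((Fintype.equivFin _).symm b) < r ((Fintype.equivFin _).symm a) := by
        intro a b hb
        obtain ⟨w, hw, rfl⟩ := List.mem_map.1 hb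
        rw [Equiv.symm_apply_apply]
        exact hr _ _ hw
      intro a b h
      induction h with
      | single h => exact one _ _ h
      | tail _ h ih => exact (one _ _ h).trans ih
    exact (key k k hk).false
  degree_ne_one k := by
    rw [List.length_map]
    rcases (Fintype.equivFin G.SplitVertex).symm k with i | ⟨i, b⟩
    · simp only [splitOut]
      split_ifs with h
      · simp
      · rw [List.length_map]; exact G.degree_ne_one i
    · simp only [splitOut]
      rw [List.length_map]; exact G.degree_ne_one i
  op k := G.splitOp ((Fintype.equivFin _).symm k)
  sign k l := G.splitSign ((Fintype.equivFin _).symm k) ((Fintype.equivFin _).symm l)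
  var k := G.splitVar ((Fintype.equivFin _).symm k)
  root := Fintype.equivFin _ (.inl G.root)

/-- The values of the vertices after the XORs are replaced. -/
noncomputable def splitValue (x : Fin N → Bool) (v : G.SplitVertex) : Bool :=
  G.splitXor.value x (Fintype.equivFin _ v)

theorem splitValue_eq (x : Fin N → Bool) (v : G.SplitVertex) :
    G.splitValue x v = if G.splitOut v = [] then x (G.splitVar v)
      else (G.splitOp v).eval ((G.splitOut v).map fun w =>
        if G.splitSign v w then G.splitValue x w else !(G.splitValue x w)) := by
  unfold splitValue
  rw [value_eq]
  simp only [splitXor, Equiv.symm_apply_apply, List.map_map, List.map_eq_nil_iff,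
    Function.comp_def]

variable {G}

/-- By induction along the edges. If `α` and `γ` are the two signed arguments of an XOR, the new
ANDs compute `α ∧ ¬γ` and `¬α ∧ γ`. The signs tell the arguments apart by the head of the list,
which works because the list has no duplicates. -/
theorem splitValue_inl (hG : G.IsXorAnd) (x : Fin N → Bool) (i : Fin n) :
    G.splitValue x (.inl i) = G.value x i := by
  induction i using G.wellFounded_out.induction with
  | _ i ih =>
  by_cases hi : G.out i ≠ [] ∧ G.op i = .xor
  · obtain ⟨a, c, hac⟩ : ∃ a c, G.out i = [a, c] := by
      rcases hG i hi.1 with h | h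
      · rw [hi.2] at h; exact absurd h (by simp)
      · exact List.length_eq_two.1 h.2
    have hne : a ≠ c := by
      have := G.nodup i
      rw [hac] at this
      simpa using this
    have hinr : ∀ b, G.splitValue x (.inr (⟨i, hi⟩, b)) =
        ((G.value x a == (G.sign i a == !b)) && (G.value x c == (G.sign i c == b))) := by
      intro b
      rw [splitValue_eq]
      simp only [splitOut, splitOp, hac, List.map_cons, List.map_nil, splitSign, Gate.eval]
      rw [ih a (by rw [hac]; simp), ih c (by rw [hac]; simp)]
      rw [if_neg (by simp)]
      simp only [List.head?_cons, Option.some.injEq, decide_true, hne, decide_false]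
      generalize G.value x a = p
      generalize G.value x c = q
      generalize G.sign i a = s
      generalize G.sign i c = t
      cases b <;> cases p <;> cases q <;> cases s <;> cases t <;> rfl
    have hout : G.splitOut (.inl i) = [.inr (⟨i, hi⟩, false), .inr (⟨i, hi⟩, true)] := dif_pos hi
    rw [splitValue_eq, value_eq, if_neg hi.1, hout, if_neg (by simp), hi.2, hac]
    simp only [splitOp, hi.2, List.map_cons, List.map_nil, splitSign, Gate.eval, if_true, hinr]
    generalize G.value x a = p
    generalize G.value x c = q
    generalize G.sign i a = s
    generalize G.sign i c = t
    cases p <;> cases q <;> cases s <;> cases t <;> rfl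
  · rw [splitValue_eq, value_eq]
    simp only [splitOut, dif_neg hi, List.map_eq_nil_iff, splitVar, List.map_map]
    by_cases h0 : G.out i = []
    · simp [h0]
    · have hop : G.op i ≠ .xor := fun h => hi ⟨h0, h⟩
      rw [if_neg h0, if_neg h0]
      simp only [splitOp, if_neg hop]
      congr 1
      apply List.map_congr_left
      intro j hj
      simp only [Function.comp, splitSign]
      rw [ih j hj]
      rfl

theorem eval_splitXor (hG : G.IsXorAnd) (x : Fin N → Bool) : G.splitXor.eval x = G.eval x :=
  splitValue_inl hG x G.root

variable (G)

theorem card_xorVertex : Fintype.card G.XorVertex = G.numGates .xor :=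
  Fintype.card_subtype _

theorem splitOut_inl_eq_nil (i : Fin n) : G.splitOut (.inl i) = [] ↔ G.out i = [] := by
  simp only [splitOut]
  split_ifs with h
  · simp [h.1]
  · simp

theorem splitOut_inr_ne_nil (p : G.XorVertex × Bool) : G.splitOut (.inr p) ≠ [] := by
  simp only [splitOut, ne_eq, List.map_eq_nil_iff]
  exact p.1.2.1

/-- The vertex and edge counts of the new circuit are sums over its vertices: the old vertices, plus
two new ones per XOR that contribute equally. -/
theorem sum_splitVertex (φ : G.SplitVertex → ℕ) (ψ : Fin n → ℕ) (c : ℕ)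
    (h : ∀ i, φ (.inl i) = ψ i) (h' : ∀ p, φ (.inr p) = c) :
    ∑ k, φ ((Fintype.equivFin _).symm k) = ∑ i, ψ i + 2 * G.numGates .xor * c := by
  rw [(Fintype.equivFin G.SplitVertex).symm.sum_comp φ, Fintype.sum_sum_type,
    Finset.sum_congr rfl fun i _ => h i, Finset.sum_congr rfl fun p _ => h' p, Finset.sum_const,
    Finset.card_univ, Fintype.card_prod, card_xorVertex, Fintype.card_bool, smul_eq_mul,
    mul_comm (G.numGates .xor)]

theorem numNonSinks_splitXor :
    G.splitXor.numNonSinks = G.numNonSinks + 2 * G.numGates .xor := by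
  unfold numNonSinks
  rw [Finset.card_filter, Finset.card_filter]
  simp only [splitXor, ne_eq, List.map_eq_nil_iff]
  rw [G.sum_splitVertex (fun v => if ¬ G.splitOut v = [] then 1 else 0)
    (fun i => if ¬ G.out i = [] then 1 else 0) 1, mul_one]
  · intro i; simp only [splitOut_inl_eq_nil]
  · intro p; rw [if_pos (G.splitOut_inr_ne_nil p)]

variable {G}

theorem numGates_and_splitXor :
    G.splitXor.numGates .and = G.numGates .and + 2 * G.numGates .xor := by
  rw [numGates, numGates, Finset.card_filter, Finset.card_filter]
  simp only [splitXor, ne_eq, List.map_eq_nil_iff]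
  rw [G.sum_splitVertex (fun v => if ¬ G.splitOut v = [] ∧ G.splitOp v = .and then 1 else 0)
    (fun i => if ¬ G.out i = [] ∧ G.op i = .and then 1 else 0) 1, mul_one]
  · intro i
    simp only [splitOut_inl_eq_nil, splitOp]
    congr 1
    cases G.op i <;> simp
  · intro p; rw [if_pos ⟨G.splitOut_inr_ne_nil p, rfl⟩]

theorem numGates_or_splitXor (hG : G.IsXorAnd) : G.splitXor.numGates .or = G.numGates .xor := by
  conv_lhs => rw [numGates, Finset.card_filter]
  simp only [splitXor, ne_eq, List.map_eq_nil_iff]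
  rw [G.sum_splitVertex (fun v => if ¬ G.splitOut v = [] ∧ G.splitOp v = .or then 1 else 0)
    (fun i => if ¬ G.out i = [] ∧ G.op i = .xor then 1 else 0) 0, mul_zero, add_zero, numGates,
    Finset.card_filter]
  · intro i
    simp only [splitOut_inl_eq_nil, splitOp]
    congr 1
    by_cases h0 : G.out i = []
    · simp [h0]
    · rcases hG i h0 with h | h
      · simp [h]
      · simp [h.1]
  · intro p; simp [splitOp]

/-- The two edges of an XOR become six: two at the OR and two at each AND. -/
theorem numEdges_splitXor (hG : G.IsXorAnd) :
    G.splitXor.numEdges = G.numEdges + 4 * G.numGates .xor := by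
  have hlen : ∀ i, G.out i ≠ [] ∧ G.op i = .xor → (G.out i).length = 2 := by
    intro i hi
    rcases hG i hi.1 with h | h
    · rw [hi.2] at h; exact absurd h (by simp)
    · exact h.2
  unfold numEdges
  simp only [splitXor, List.length_map]
  rw [G.sum_splitVertex (fun v => (G.splitOut v).length) (fun i => (G.out i).length) 2]
  · ring
  · intro i
    simp only [splitOut]
    split_ifs with h
    · rw [hlen i h]; rfl
    · simp
  · intro p
    simp only [splitOut, List.length_map]
    exact hlen _ p.1.2

theorem isAndOrNot_splitXor (hG : G.IsXorAnd) : G.splitXor.IsAndOrNot := by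
  intro k hk
  simp only [splitXor, ne_eq, List.map_eq_nil_iff] at hk ⊢
  generalize (Fintype.equivFin G.SplitVertex).symm k = v at hk ⊢
  rcases v with i | p
  · rw [splitOut_inl_eq_nil] at hk
    rcases hG i hk with h | h
    · left; simp [splitOp, h]
    · right; simp [splitOp, h.1]
  · exact Or.inl rfl

theorem numGates_le_numNonSinks (g : Gate) : G.numGates g ≤ G.numNonSinks :=
  Finset.card_le_card fun i hi => by
    simp only [Finset.mem_filter] at hi ⊢
    exact ⟨hi.1, hi.2.1⟩

end CircuitDag

theorem theorem3 :
    (∃ C₁ C₂ : ℝ, ∀ n N nhat m : ℕ, 1 ≤ nhat → nhat ≤ n →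
      ∃ 𝒜 : QueryAlgorithm (Query n N) (Answer n N),
        (𝒜.queries : ℝ) ≤ C₁ * (Real.sqrt (nhat * m) * Real.log nhat) ∧
        (𝒜.queries : ℝ) ≤ C₁ * (Real.sqrt (n * m) * Real.log n) ∧
        ∀ G : CircuitDag n N, G.IsXorAnd → G.numNonSinks = nhat → G.numEdges = m →
          ∀ x : Fin N → Bool, 𝒜.prob (G.oracle x) (!(G.eval x)) ≤ C₂ / nhat) ∧
    (∀ (n N : ℕ) (G : CircuitDag n N), G.IsXorAnd →
      ∃ (n' : ℕ) (G' : CircuitDag n' N), G'.IsAndOrNot ∧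
        (∀ x : Fin N → Bool, G'.eval x = G.eval x) ∧
        G'.numGates .and = G.numGates .and + 2 * G.numGates .xor ∧
        G'.numGates .or = G.numGates .xor ∧
        G'.numNonSinks ≤ 3 * G.numNonSinks ∧
        G'.numEdges = G.numEdges + 4 * G.numGates .xor ∧
        G'.numEdges ≤ 6 * G.numEdges) := by
  refine ⟨⟨40000, 1, fun n N nhat m h1 hn => ?_⟩, fun n N G hG => ?_⟩
  · obtain ⟨𝒜, hq, h𝒜⟩ := CircuitSearch.exists_algorithm n N nhat m h1 hn
    refine ⟨𝒜, hq, hq.trans ?_, h𝒜⟩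
    have h1' : (1 : ℝ) ≤ nhat := by exact_mod_cast h1
    have hn' : (nhat : ℝ) ≤ n := by exact_mod_cast hn
    have hlog : 0 ≤ Real.log nhat := Real.log_nonneg h1'
    have hlog' : Real.log nhat ≤ Real.log n := Real.log_le_log (by linarith) hn'
    gcongr
  · have h1 := G.numNonSinks_mul_two_le
    have h2 := G.numGates_le_numNonSinks .xor
    have h3 := G.numNonSinks_splitXor
    have h4 := CircuitDag.numEdges_splitXor hG
    -- With k XORs and n̂ non-sinks, `k ≤ n̂` and `2n̂ ≤ m` give `n̂ + 2k ≤ 3n̂` and `m + 4k ≤ 3m`.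
    exact ⟨_, G.splitXor, CircuitDag.isAndOrNot_splitXor hG, CircuitDag.eval_splitXor hG,
      CircuitDag.numGates_and_splitXor, CircuitDag.numGates_or_splitXor hG, by omega, h4,
      by omega⟩
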